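/- For a positive integer $m$, let $\omega(m)$ be the number of distinct prime factors of $m$ and $\Omega(m)$ the number of prime factors of $m$ counted with multiplicity. There exists a constant $C>0$ such that, for infinitely many positive integers $n$, one has $$\omega(n-k)\le\Omega(n-k)\le C\log k\qquad\text{for every integer } 1<k<n.$$ -/

import Mathlib

/-!
# Integers `n` such that every `n - k` has few prime factors

Let `y = 4 ^ J` and `z = y ^ (4 ^ J)`, and look for `n ≡ 1` modulo `W = (y!) ^ 2` below a fixed
power of `z`. The congruence settles the primes up to `y`: with `g = gcd (W, k - 1)`, the number
`n - k` is `g` times a cofactor, `Ω g ≤ log₂ k`, and for `k ≤ y` the cofactor is free of primes up to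
`y`. For `k > y` these primes are harmless, their reciprocals having sum `O(log y)`.
The factor `g` is where `k = 1` has to be excluded. For `k > z` the bound `Ω (n - k) ≤ log₂ n` is enough, and
for every `k` at most `O(log k)` prime factors of `n - k` exceed `z ^ (1 / log₂ k)`.

The remaining primes, between `y` and `z`, fall into `J` blocks `(u, u ^ 4]`, over each of which the
sum of `1 / p` is at most `12`. In block `i` all classes `n ≡ k' [MOD p]` with
`2 ≤ k' ≤ 2 ^ (J - i)` are sieved out, so that a given `k` still meets primes of at most `log₂ k`
blocks. The expected number of the corresponding prime factors of `n - k` is then `O(log k)`, and by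
Rankin's trick it is very unlikely, with probability below `k⁻² / 16`, that there are more than
`600 * log₂ k` of them (`sum_badDivisors_le`). These probabilities can be summed over `k`.

The number of sieved classes grows from block to block towards the small primes, but slowly enough
for a Brun sieve: in block `i` the inclusion–exclusion is truncated at level `O(2 ^ (J - i))`, and
since the primes of that block are at most `z ^ (4 ^ (i + 1 - J))`, all moduli stay below a fixed
power of `z`. The weight is the product over the blocks of upper Bonferroni sums. It is nonnegative,
and the mass it puts on integers that are not sifted is controlled by the first omitted terms. The sieve
is `exists_sifted`. It works with two properties of linear combinations of indicators of residue
classes: their mean values multiply over coprime periods (`HasMean.mul_of_coprime`), and their sum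
over an interval deviates from the mean by at most a submultiplicative norm
(`ClassNormLE.abs_sum_sub_le`).
-/

/-! ### Mean values over the natural numbers and their discrepancy -/

/-- The indicator, as a real number, of the residue class `m ≡ a [MOD d]`. -/
noncomputable def classInd (d a m : ℕ) : ℝ := if m ≡ a [MOD d] then 1 else 0

/-- `HasMean F μ`: the averages of `F` over `[0, X)` tend to `μ`. -/
def HasMean (F : ℕ → ℝ) (μ : ℝ) : Prop :=
  Filter.Tendsto (fun X : ℕ => (∑ m ∈ Finset.range X, F m) / X) Filter.atTop (nhds μ)

/-- `ClassNormLE F E`: `F` is a linear combination of indicators of residue classes whose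
coefficients have absolute values summing to `E`. By `ClassNormLE.mono`, which pads with cancelling
terms, `E` may be replaced by anything larger, so this is an upper bound for a norm, which is
submultiplicative and dominates the discrepancy of `F` on every interval `[0, X)`. -/
inductive ClassNormLE : (ℕ → ℝ) → ℝ → Prop
  | zero : ClassNormLE (fun _ => 0) 0
  | ind (d a : ℕ) (hd : 0 < d) : ClassNormLE (fun m => classInd d a m) 1
  | smul (c : ℝ) {F : ℕ → ℝ} {E : ℝ} : ClassNormLE F E → ClassNormLE (fun m => c * F m) (|c| * E)
  | add {F G : ℕ → ℝ} {E E' : ℝ} :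
      ClassNormLE F E → ClassNormLE G E' → ClassNormLE (fun m => F m + G m) (E + E')

lemma classInd_nonneg (d a m : ℕ) : 0 ≤ classInd d a m := by
  unfold classInd; split_ifs <;> norm_num

lemma abs_sum_classInd_sub_le {d : ℕ} (hd : 0 < d) (a X : ℕ) :
    |∑ m ∈ Finset.range X, classInd d a m - X * (1 / d)| ≤ 1 := by
  have h1 : ∑ m ∈ Finset.range X, classInd d a m = (Nat.count (fun x => x ≡ a [MOD d]) X : ℝ) := by
    unfold classInd
    rw [Nat.count_eq_card_filter_range, Finset.sum_boole]
  have hd' : (0 : ℝ) < d := by exact_mod_cast hd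
  rw [h1, Nat.count_modEq_card X hd a]
  have h2 : (X : ℝ) = d * (X / d : ℕ) + (X % d : ℕ) := by exact_mod_cast (Nat.div_add_mod X d).symm
  have h3 : ((X % d : ℕ) : ℝ) < d := by exact_mod_cast Nat.mod_lt X hd
  have h4 : (X : ℝ) * (1 / d) = (X / d : ℕ) + (X % d : ℕ) / (d : ℝ) := by
    conv_lhs => rw [h2]
    field_simp
  have h5 : ((X % d : ℕ) : ℝ) / (d : ℝ) < 1 := by rw [div_lt_one hd']; exact h3
  have h6 : 0 ≤ ((X % d : ℕ) : ℝ) / (d : ℝ) := by positivity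
  rw [h4, abs_le]
  push_cast
  split_ifs <;> constructor <;> linarith

lemma hasMean_of_abs_le {F : ℕ → ℝ} {μ E : ℝ}
    (h : ∀ X : ℕ, |∑ m ∈ Finset.range X, F m - X * μ| ≤ E) : HasMean F μ := by
  unfold HasMean
  rw [tendsto_iff_norm_sub_tendsto_zero]
  have hlim : Filter.Tendsto (fun X : ℕ => E / (X : ℝ)) Filter.atTop (nhds 0) :=
    tendsto_const_div_atTop_nhds_zero_nat E
  refine tendsto_of_tendsto_of_tendsto_of_le_of_le' tendsto_const_nhds hlim ?_ ?_
  · exact Filter.Eventually.of_forall fun X => norm_nonneg _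
  · filter_upwards [Filter.eventually_gt_atTop 0] with X hX
    have hX' : (0 : ℝ) < X := by exact_mod_cast hX
    have : (∑ m ∈ Finset.range X, F m) / X - μ = (∑ m ∈ Finset.range X, F m - X * μ) / X := by
      field_simp
    rw [this, Real.norm_eq_abs, abs_div, abs_of_pos hX']
    exact div_le_div_of_nonneg_right (h X) hX'.le

namespace HasMean

lemma residueClass {d : ℕ} (hd : 0 < d) (a : ℕ) : HasMean (fun m => classInd d a m) (1 / d) :=
  hasMean_of_abs_le (abs_sum_classInd_sub_le hd a)

lemma add {F G : ℕ → ℝ} {μ ν : ℝ} (hF : HasMean F μ) (hG : HasMean G ν) :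
    HasMean (fun m => F m + G m) (μ + ν) := by
  unfold HasMean at *
  simpa only [Finset.sum_add_distrib, add_div] using Filter.Tendsto.add hF hG

lemma const_mul {F : ℕ → ℝ} {μ : ℝ} (c : ℝ) (hF : HasMean F μ) :
    HasMean (fun m => c * F m) (c * μ) := by
  unfold HasMean at *
  simpa only [← Finset.mul_sum, mul_div_assoc] using Filter.Tendsto.const_mul c hF

lemma const (c : ℝ) : HasMean (fun _ => c) c := by
  refine hasMean_of_abs_le (E := 0) fun X => ?_
  simp

lemma sub {F G : ℕ → ℝ} {μ ν : ℝ} (hF : HasMean F μ) (hG : HasMean G ν) :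
    HasMean (fun m => F m - G m) (μ - ν) := by
  simpa [sub_eq_add_neg] using hF.add (hG.const_mul (-1))

lemma sum {ι : Type*} {s : Finset ι} {F : ι → ℕ → ℝ} {μ : ι → ℝ}
    (h : ∀ i ∈ s, HasMean (F i) (μ i)) :
    HasMean (fun m => ∑ i ∈ s, F i m) (∑ i ∈ s, μ i) := by
  classical
  induction s using Finset.induction_on with
  | empty => simpa using HasMean.const 0
  | insert a s ha ih =>
    simp only [Finset.sum_insert ha]
    exact (h a (Finset.mem_insert_self a s)).add
      (ih fun i hi => h i (Finset.mem_insert_of_mem hi))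

lemma congr {F G : ℕ → ℝ} {μ : ℝ} (hF : HasMean F μ) (h : ∀ m, G m = F m) : HasMean G μ := by
  rwa [show G = F from funext h]

lemma unique {F : ℕ → ℝ} {μ ν : ℝ} (h : HasMean F μ) (h' : HasMean F ν) : μ = ν :=
  tendsto_nhds_unique h h'

lemma mono {F G : ℕ → ℝ} {μ ν : ℝ} (hF : HasMean F μ) (hG : HasMean G ν)
    (h : ∀ m, F m ≤ G m) : μ ≤ ν :=
  le_of_tendsto_of_tendsto' hF hG fun X =>
    div_le_div_of_nonneg_right (Finset.sum_le_sum fun m _ => h m) (Nat.cast_nonneg X)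

lemma nonneg {F : ℕ → ℝ} {μ : ℝ} (hF : HasMean F μ) (h : ∀ m, 0 ≤ F m) : 0 ≤ μ :=
  (HasMean.const 0).mono hF h

end HasMean

lemma Function.Periodic.eq_of_modEq {F : ℕ → ℝ} {Q : ℕ} (hF : Function.Periodic F Q) {m n : ℕ}
    (h : m ≡ n [MOD Q]) : F m = F n := by
  rw [← hF.map_mod_nat m, ← hF.map_mod_nat n, h]

/-- A function of period `Q` is a linear combination of the indicators of the classes mod `Q`. -/
lemma Function.Periodic.eq_sum_classInd {F : ℕ → ℝ} {Q : ℕ} (hQ : 0 < Q)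
    (hF : Function.Periodic F Q) (m : ℕ) :
    F m = ∑ a ∈ Finset.range Q, F a * classInd Q a m := by
  rw [Finset.sum_eq_single (m % Q)]
  · rw [hF.map_mod_nat]
    simp [classInd, Nat.ModEq]
  · intro b hb hne
    rw [classInd, if_neg, mul_zero]
    intro h
    apply hne
    rw [h, Nat.mod_eq_of_lt (Finset.mem_range.1 hb)]
  · intro h
    exact absurd (Finset.mem_range.2 (Nat.mod_lt m hQ)) h

/-- The average of `F` over one period `Q`. -/
noncomputable def periodAvg (Q : ℕ) (F : ℕ → ℝ) : ℝ := ∑ a ∈ Finset.range Q, F a * (1 / Q)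

lemma Function.Periodic.hasMean {F : ℕ → ℝ} {Q : ℕ} (hQ : 0 < Q) (hF : Function.Periodic F Q) :
    HasMean F (periodAvg Q F) :=
  HasMean.congr (HasMean.sum fun a _ => (HasMean.residueClass hQ a).const_mul (F a))
    (hF.eq_sum_classInd hQ)

lemma exists_classInd_mul_classInd {d e : ℕ} (h : d.Coprime e) (a b : ℕ) :
    ∃ c, ∀ m, classInd d a m * classInd e b m = classInd (d * e) c m := by
  obtain ⟨c, hca, hcb⟩ := Nat.chineseRemainder h a b
  refine ⟨c, fun m => ?_⟩
  have : (m ≡ a [MOD d] ∧ m ≡ b [MOD e]) ↔ m ≡ c [MOD d * e] := by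
    rw [← Nat.modEq_and_modEq_iff_modEq_mul h]
    exact ⟨fun ⟨h1, h2⟩ => ⟨h1.trans hca.symm, h2.trans hcb.symm⟩,
      fun ⟨h1, h2⟩ => ⟨h1.trans hca, h2.trans hcb⟩⟩
  unfold classInd
  by_cases h1 : m ≡ a [MOD d] <;> by_cases h2 : m ≡ b [MOD e] <;> simp [← this, h1, h2]

/-- Periodic functions with coprime periods are uncorrelated (Chinese remainder theorem). -/
lemma HasMean.mul_of_coprime {F G : ℕ → ℝ} {P Q : ℕ} {μ ν : ℝ} (hP : 0 < P) (hQ : 0 < Q)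
    (hPQ : P.Coprime Q) (hF : Function.Periodic F P) (hG : Function.Periodic G Q)
    (hFμ : HasMean F μ) (hGν : HasMean G ν) : HasMean (fun m => F m * G m) (μ * ν) := by
  rw [hFμ.unique (hF.hasMean hP), hGν.unique (hG.hasMean hQ), periodAvg, periodAvg,
    Finset.sum_mul_sum]
  refine HasMean.congr (F := fun m => ∑ a ∈ Finset.range P, ∑ b ∈ Finset.range Q,
    F a * G b * (classInd P a m * classInd Q b m)) ?_ ?_
  · refine HasMean.sum fun a _ => HasMean.sum fun b _ => ?_
    obtain ⟨c, hc⟩ := exists_classInd_mul_classInd hPQ a b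
    have := (HasMean.residueClass (Nat.mul_pos hP hQ) c).const_mul (F a * G b)
    simp only [hc]
    convert this using 1
    push_cast
    field_simp
  · intro m
    rw [hF.eq_sum_classInd hP m, hG.eq_sum_classInd hQ m, Finset.sum_mul_sum]
    refine Finset.sum_congr rfl fun a _ => Finset.sum_congr rfl fun b _ => by ring

lemma Function.Periodic.of_dvd {F : ℕ → ℝ} {P Q : ℕ} (hF : Function.Periodic F P) (h : P ∣ Q) :
    Function.Periodic F Q := by
  obtain ⟨c, rfl⟩ := h
  intro m
  exact hF.eq_of_modEq (by simp [Nat.ModEq])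

lemma Function.Periodic.finset_prod {ι : Type*} {s : Finset ι} {F : ι → ℕ → ℝ} {Q : ι → ℕ}
    (h : ∀ i ∈ s, Function.Periodic (F i) (Q i)) :
    Function.Periodic (fun m => ∏ i ∈ s, F i m) (∏ i ∈ s, Q i) := by
  intro m
  exact Finset.prod_congr rfl fun i hi => (h i hi).of_dvd (Finset.dvd_prod_of_mem Q hi) m

lemma HasMean.prod_of_coprime {ι : Type*} {s : Finset ι} {F : ι → ℕ → ℝ} {Q : ι → ℕ} {μ : ι → ℝ}
    (hQ : ∀ i ∈ s, 0 < Q i) (hco : (s : Set ι).Pairwise fun i j => (Q i).Coprime (Q j))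
    (hF : ∀ i ∈ s, Function.Periodic (F i) (Q i)) (h : ∀ i ∈ s, HasMean (F i) (μ i)) :
    HasMean (fun m => ∏ i ∈ s, F i m) (∏ i ∈ s, μ i) := by
  classical
  induction s using Finset.induction_on with
  | empty => simpa using HasMean.const 1
  | insert a s ha ih =>
    simp only [Finset.prod_insert ha]
    have hs : ∀ i ∈ s, i ∈ insert a s := fun i hi => Finset.mem_insert_of_mem hi
    refine HasMean.mul_of_coprime (hQ a (Finset.mem_insert_self a s))
      (Finset.prod_pos fun i hi => hQ i (hs i hi)) ?_ (hF a (Finset.mem_insert_self a s))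
      (Function.Periodic.finset_prod fun i hi => hF i (hs i hi))
      (h a (Finset.mem_insert_self a s)) (ih (fun i hi => hQ i (hs i hi)) ?_
        (fun i hi => hF i (hs i hi)) (fun i hi => h i (hs i hi)))
    · refine Nat.Coprime.prod_right fun i hi => hco (by simp) (by simp [hi]) ?_
      rintro rfl
      exact ha hi
    · exact hco.mono (by simp)

namespace ClassNormLE

lemma congr {F G : ℕ → ℝ} {E : ℝ} (hF : ClassNormLE F E) (h : ∀ m, G m = F m) :
    ClassNormLE G E := by
  rwa [show G = F from funext h]

lemma congr_right {F : ℕ → ℝ} {E E' : ℝ} (hF : ClassNormLE F E) (h : E' = E) :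
    ClassNormLE F E' := by
  rwa [h]

lemma mono {F : ℕ → ℝ} {E E' : ℝ} (hF : ClassNormLE F E) (h : E ≤ E') : ClassNormLE F E' := by
  -- the zero function is a combination of any prescribed total weight
  have h0 : ClassNormLE (fun _ => 0) (E' - E) := by
    have h1 := (ClassNormLE.smul ((E' - E) / 2) (ClassNormLE.ind 1 0 one_pos)).add
      (ClassNormLE.smul (-((E' - E) / 2)) (ClassNormLE.ind 1 0 one_pos))
    refine (h1.congr fun m => by ring).congr_right ?_
    rw [abs_neg, abs_of_nonneg (by linarith)]
    ring
  exact ((hF.add h0).congr fun m => by ring).congr_right (by ring)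

lemma sum {ι : Type*} {s : Finset ι} {F : ι → ℕ → ℝ} {E : ι → ℝ}
    (h : ∀ i ∈ s, ClassNormLE (F i) (E i)) :
    ClassNormLE (fun m => ∑ i ∈ s, F i m) (∑ i ∈ s, E i) := by
  classical
  induction s using Finset.induction_on with
  | empty => simpa using ClassNormLE.zero
  | insert a s ha ih =>
    simp only [Finset.sum_insert ha]
    exact (h a (Finset.mem_insert_self a s)).add
      (ih fun i hi => h i (Finset.mem_insert_of_mem hi))

lemma sub {F G : ℕ → ℝ} {E E' : ℝ} (hF : ClassNormLE F E) (hG : ClassNormLE G E') :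
    ClassNormLE (fun m => F m - G m) (E + E') :=
  ((hF.add (hG.smul (-1))).congr fun m => by ring).congr_right (by simp)

lemma one : ClassNormLE (fun _ => 1) 1 :=
  (ClassNormLE.ind 1 0 one_pos).congr fun m => by simp [classInd, Nat.modEq_one]

lemma classInd_mul (d a : ℕ) (hd : 0 < d) {G : ℕ → ℝ} {E : ℝ} (hG : ClassNormLE G E) :
    ClassNormLE (fun m => classInd d a m * G m) E := by
  induction hG with
  | zero => exact ClassNormLE.zero.congr fun m => by ring
  | ind e b he =>
    by_cases h : ∃ c, c ≡ a [MOD d] ∧ c ≡ b [MOD e]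
    · obtain ⟨c, hca, hcb⟩ := h
      refine (ClassNormLE.ind (Nat.lcm d e) c (Nat.lcm_pos hd he)).congr fun m => ?_
      have : (m ≡ a [MOD d] ∧ m ≡ b [MOD e]) ↔ m ≡ c [MOD Nat.lcm d e] := by
        refine ⟨fun ⟨h1, h2⟩ => ?_, fun h => ?_⟩
        · have h3 := Int.natCast_modEq_iff.2 (h1.trans hca.symm)
          have h4 := Int.natCast_modEq_iff.2 (h2.trans hcb.symm)
          have h5 := Int.modEq_and_modEq_iff_modEq_lcm.1 ⟨h3, h4⟩
          exact Int.natCast_modEq_iff.1 (by simpa [Int.lcm] using h5)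
        · exact ⟨(h.of_dvd (Nat.dvd_lcm_left d e)).trans hca,
            (h.of_dvd (Nat.dvd_lcm_right d e)).trans hcb⟩
      unfold classInd
      by_cases h1 : m ≡ a [MOD d] <;> by_cases h2 : m ≡ b [MOD e] <;> simp [← this, h1, h2]
    · refine (ClassNormLE.zero.mono zero_le_one).congr fun m => ?_
      unfold classInd
      by_cases h1 : m ≡ a [MOD d] <;> by_cases h2 : m ≡ b [MOD e] <;> simp [h1, h2]
      exact h ⟨m, h1, h2⟩
  | smul c _ ih => exact (ih.smul c).congr fun m => by ring
  | add _ _ ih ih' => exact (ih.add ih').congr fun m => by ring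

lemma mul {F G : ℕ → ℝ} {E E' : ℝ} (hF : ClassNormLE F E) (hG : ClassNormLE G E') :
    ClassNormLE (fun m => F m * G m) (E * E') := by
  induction hF with
  | zero => exact (ClassNormLE.zero.congr fun m => by ring).congr_right (by ring)
  | ind d a hd => exact (hG.classInd_mul d a hd).congr_right (by ring)
  | smul c _ ih => exact ((ih.smul c).congr fun m => by ring).congr_right (by ring)
  | add _ _ ih ih' => exact ((ih.add ih').congr fun m => by ring).congr_right (by ring)

lemma prod {ι : Type*} {s : Finset ι} {F : ι → ℕ → ℝ} {E : ι → ℝ}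
    (h : ∀ i ∈ s, ClassNormLE (F i) (E i)) :
    ClassNormLE (fun m => ∏ i ∈ s, F i m) (∏ i ∈ s, E i) := by
  classical
  induction s using Finset.induction_on with
  | empty => simpa using ClassNormLE.one
  | insert a s ha ih =>
    simp only [Finset.prod_insert ha]
    exact (h a (Finset.mem_insert_self a s)).mul
      (ih fun i hi => h i (Finset.mem_insert_of_mem hi))

lemma of_periodic {F : ℕ → ℝ} {Q : ℕ} (hQ : 0 < Q) (hF : Function.Periodic F Q)
    (h : ∀ m, |F m| ≤ 1) : ClassNormLE F Q := by
  refine ((ClassNormLE.sum fun a (_ : a ∈ Finset.range Q) =>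
    (ClassNormLE.ind Q a hQ).smul (F a)).congr (hF.eq_sum_classInd hQ)).mono ?_
  calc ∑ a ∈ Finset.range Q, |F a| * 1 ≤ ∑ a ∈ Finset.range Q, (1 : ℝ) :=
        Finset.sum_le_sum fun a _ => by simpa using h a
    _ = Q := by simp

lemma exists_abs_sum_sub_le {F : ℕ → ℝ} {E : ℝ} (hF : ClassNormLE F E) :
    ∃ μ, ∀ X : ℕ, |∑ m ∈ Finset.range X, F m - X * μ| ≤ E := by
  induction hF with
  | zero => exact ⟨0, fun X => by simp⟩
  | ind d a hd => exact ⟨1 / d, abs_sum_classInd_sub_le hd a⟩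
  | smul c _ ih =>
    obtain ⟨μ, h⟩ := ih
    refine ⟨c * μ, fun X => ?_⟩
    rw [← Finset.mul_sum, mul_left_comm, ← mul_sub, abs_mul]
    exact mul_le_mul_of_nonneg_left (h X) (abs_nonneg c)
  | add _ _ ih ih' =>
    obtain ⟨μ, h⟩ := ih
    obtain ⟨ν, h'⟩ := ih'
    refine ⟨μ + ν, fun X => ?_⟩
    rw [Finset.sum_add_distrib, mul_add, add_sub_add_comm]
    exact (abs_add_le _ _).trans (add_le_add (h X) (h' X))

lemma abs_sum_sub_le {F : ℕ → ℝ} {E μ : ℝ} (hF : ClassNormLE F E) (hμ : HasMean F μ) (X : ℕ) :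
    |∑ m ∈ Finset.range X, F m - X * μ| ≤ E := by
  obtain ⟨ν, h⟩ := hF.exists_abs_sum_sub_le
  rw [hμ.unique (hasMean_of_abs_le h)]
  exact h X

end ClassNormLE

/-! ### Truncated inclusion–exclusion over one block of primes -/

/-- The partial sum of `∑ (-1) ^ i * choose a i` over `i ≤ 2 * r`: an upper Bonferroni weight for the
condition `a = 0`. -/
def bonferroni (r a : ℕ) : ℝ := ∑ i ∈ Finset.range (2 * r + 1), (-1) ^ i * (a.choose i : ℝ)

lemma bonferroni_zero (r : ℕ) : bonferroni r 0 = 1 := by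
  unfold bonferroni
  rw [Finset.sum_eq_single 0]
  · simp
  · intro b _ hb
    rw [Nat.choose_eq_zero_of_lt (Nat.pos_of_ne_zero hb)]
    simp
  · simp

lemma bonferroni_succ (r a : ℕ) : bonferroni r (a + 1) = (a.choose (2 * r) : ℝ) := by
  have h := @Int.alternating_sum_range_choose_eq_choose a (2 * r)
  rw [pow_mul, neg_one_sq, one_pow, one_mul] at h
  unfold bonferroni
  exact_mod_cast congrArg (fun z : ℤ => (z : ℝ)) h

lemma bonferroni_nonneg (r a : ℕ) : 0 ≤ bonferroni r a := by
  cases a with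
  | zero => rw [bonferroni_zero]; exact zero_le_one
  | succ a => rw [bonferroni_succ]; positivity

lemma bonferroni_le_choose (r : ℕ) {a : ℕ} (ha : a ≠ 0) :
    bonferroni r a ≤ (a.choose (2 * r + 1) : ℝ) := by
  obtain ⟨b, rfl⟩ := Nat.exists_eq_succ_of_ne_zero ha
  rw [Nat.succ_eq_add_one, bonferroni_succ, Nat.choose_succ_succ]
  push_cast
  have : (0 : ℝ) ≤ (b.choose (2 * r + 1) : ℝ) := by positivity
  linarith

/-- The elementary symmetric sum of degree `s` of the values of `x` on `B`. -/
def elemSym (x : ℕ → ℝ) (B : Finset ℕ) (s : ℕ) : ℝ :=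
  ∑ T ∈ B.powersetCard s, ∏ p ∈ T, x p

lemma elemSym_nonneg {x : ℕ → ℝ} {B : Finset ℕ} (hx : ∀ p ∈ B, 0 ≤ x p) (s : ℕ) :
    0 ≤ elemSym x B s :=
  Finset.sum_nonneg fun _ hT => Finset.prod_nonneg fun p hp =>
    hx p ((Finset.mem_powersetCard.1 hT).1 hp)

lemma elemSym_mono {x : ℕ → ℝ} {A B : Finset ℕ} (hAB : A ⊆ B) (hx : ∀ p ∈ B, 0 ≤ x p) (s : ℕ) :
    elemSym x A s ≤ elemSym x B s :=
  Finset.sum_le_sum_of_subset_of_nonneg (Finset.powersetCard_mono hAB) fun _ hT _ =>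
    Finset.prod_nonneg fun p hp => hx p ((Finset.mem_powersetCard.1 hT).1 hp)

lemma elemSym_le_sum_pow {x : ℕ → ℝ} {B : Finset ℕ} (hx : ∀ p ∈ B, 0 ≤ x p) (s : ℕ) :
    elemSym x B s ≤ (∑ p ∈ B, x p) ^ s := by
  classical
  induction B using Finset.induction_on generalizing s with
  | empty =>
    cases s with
    | zero => simp [elemSym]
    | succ s => rw [elemSym, Finset.powersetCard_eq_empty.2 (by simp)]; simp
  | insert a B ha ih =>
    have hB : ∀ p ∈ B, 0 ≤ x p := fun p hp => hx p (Finset.mem_insert_of_mem hp)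
    cases s with
    | zero => simp [elemSym]
    | succ s =>
      have hxa := hx a (Finset.mem_insert_self a B)
      have hσ : 0 ≤ ∑ p ∈ B, x p := Finset.sum_nonneg hB
      have h1 : elemSym x (insert a B) (s + 1) = elemSym x B (s + 1) + x a * elemSym x B s := by
        unfold elemSym
        rw [Finset.powersetCard_succ_insert ha, Finset.sum_union, Finset.sum_image, Finset.mul_sum]
        · congr 1
          refine Finset.sum_congr rfl fun T hT => ?_
          rw [Finset.prod_insert fun h => ha ((Finset.mem_powersetCard.1 hT).1 h)]
        · intro T hT T' hT' h
          have hT1 : a ∉ T := fun h => ha ((Finset.mem_powersetCard.1 hT).1 h)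
          have hT2 : a ∉ T' := fun h => ha ((Finset.mem_powersetCard.1 hT').1 h)
          rw [← Finset.erase_insert hT1, ← Finset.erase_insert hT2, h]
        · rw [Finset.disjoint_left]
          intro T hT hT'
          obtain ⟨T', _, rfl⟩ := Finset.mem_image.1 hT'
          exact ha ((Finset.mem_powersetCard.1 hT).1 (Finset.mem_insert_self a T'))
      rw [h1, Finset.sum_insert ha]
      calc elemSym x B (s + 1) + x a * elemSym x B s
          ≤ (∑ p ∈ B, x p) ^ (s + 1) + x a * (∑ p ∈ B, x p) ^ s :=
            add_le_add (ih hB _) (mul_le_mul_of_nonneg_left (ih hB _) hxa)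
        _ = (x a + ∑ p ∈ B, x p) * (∑ p ∈ B, x p) ^ s := by ring
        _ ≤ (x a + ∑ p ∈ B, x p) * (x a + ∑ p ∈ B, x p) ^ s := by gcongr; linarith
        _ = _ := by ring

/-- Rankin's trick for elementary symmetric sums, with parameter `e`. -/
lemma elemSym_le_exp {x : ℕ → ℝ} {B : Finset ℕ} (hx : ∀ p ∈ B, 0 ≤ x p) (s : ℕ) :
    elemSym x B s ≤ Real.exp (3 * ∑ p ∈ B, x p - s) := by
  have h1 : Real.exp s * elemSym x B s ≤ ∏ p ∈ B, (1 + Real.exp 1 * x p) := by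
    rw [Finset.prod_one_add, elemSym, Finset.mul_sum]
    refine le_trans (le_of_eq ?_) (Finset.sum_le_sum_of_subset_of_nonneg
      (s := B.powersetCard s) (fun T hT => Finset.mem_powerset.2 (Finset.mem_powersetCard.1 hT).1)
      fun T hT _ => Finset.prod_nonneg fun p hp => mul_nonneg (Real.exp_pos 1).le (hx p
        (Finset.mem_powerset.1 hT hp)))
    refine Finset.sum_congr rfl fun T hT => ?_
    rw [Finset.prod_mul_distrib, Finset.prod_const, (Finset.mem_powersetCard.1 hT).2,
      ← Real.exp_nat_mul, mul_one]
  have h2 : ∏ p ∈ B, (1 + Real.exp 1 * x p) ≤ Real.exp (3 * ∑ p ∈ B, x p) := by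
    rw [Finset.mul_sum, Real.exp_sum]
    refine Finset.prod_le_prod (fun p hp => ?_) fun p hp => ?_
    · have := mul_nonneg (Real.exp_pos 1).le (hx p hp)
      linarith
    · have h3 : Real.exp 1 * x p ≤ 3 * x p :=
        mul_le_mul_of_nonneg_right (by linarith [Real.exp_one_lt_d9]) (hx p hp)
      linarith [Real.add_one_le_exp (3 * x p)]
  rw [Real.exp_sub, le_div_iff₀ (Real.exp_pos _), mul_comm]
  exact h1.trans h2

open Classical in
/-- The indicator of `R p`. -/
noncomputable def condInd (R : ℕ → ℕ → Prop) (p m : ℕ) : ℝ := if R p m then 1 else 0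

open Classical in
/-- The number of `p ∈ B` for which `R p m` holds. -/
noncomputable def hits (R : ℕ → ℕ → Prop) (B : Finset ℕ) (m : ℕ) : ℕ := (B.filter (R · m)).card

/-- The density of the set of `m` satisfying `R p m`, when that condition has period `p`. -/
noncomputable def condDensity (R : ℕ → ℕ → Prop) (p : ℕ) : ℝ := periodAvg p (condInd R p)

lemma condInd_nonneg (R : ℕ → ℕ → Prop) (p m : ℕ) : 0 ≤ condInd R p m := by
  unfold condInd; split_ifs <;> norm_num

lemma hits_eq_zero {R : ℕ → ℕ → Prop} {B : Finset ℕ} {m : ℕ} :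
    hits R B m = 0 ↔ ∀ p ∈ B, ¬ R p m := by
  simp [hits, Finset.filter_eq_empty_iff]

section Block

variable {R : ℕ → ℕ → Prop} {B : Finset ℕ}

lemma choose_hits (s m : ℕ) :
    ((hits R B m).choose s : ℝ) = elemSym (fun p => condInd R p m) B s := by
  classical
  have h1 : ∀ T : Finset ℕ, ∏ p ∈ T, condInd R p m = if ∀ p ∈ T, R p m then (1 : ℝ) else 0 := by
    intro T
    unfold condInd
    rw [Finset.prod_boole]
  unfold hits elemSym
  rw [← Finset.card_powersetCard]
  simp only [h1]
  rw [Finset.sum_boole]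
  congr 2
  ext T
  simp only [Finset.mem_powersetCard, Finset.mem_filter, Finset.subset_iff]
  grind

lemma ite_hits_eq_prod (m : ℕ) :
    (if hits R B m = 0 then (1 : ℝ) else 0) = ∏ p ∈ B, (1 - condInd R p m) := by
  classical
  have : ∀ p, 1 - condInd R p m = if ¬ R p m then (1 : ℝ) else 0 := by
    intro p; unfold condInd; split_ifs <;> simp_all
  simp only [this, Finset.prod_boole, hits_eq_zero]

lemma pairwise_coprime_of_primes (hB : ∀ p ∈ B, p.Prime) :
    (B : Set ℕ).Pairwise fun p q => p.Coprime q :=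
  fun p hp q hq h => (Nat.coprime_primes (hB p hp) (hB q hq)).2 h

lemma condInd_periodic
    (hR : ∀ p ∈ B, ∀ m, R p (m + p) ↔ R p m)
    {p : ℕ} (hp : p ∈ B) : Function.Periodic (condInd R p) p := by
  intro m
  have h := hR p hp m
  by_cases h1 : R p m <;> simp [condInd, h, h1]

lemma hits_periodic
    (hR : ∀ p ∈ B, ∀ m, R p (m + p) ↔ R p m)
    (f : ℕ → ℝ) :
    Function.Periodic (fun m => f (hits R B m)) (∏ p ∈ B, p) := by
  classical
  intro m
  have : hits R B (m + ∏ p ∈ B, p) = hits R B m := by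
    unfold hits
    congr 1
    refine Finset.filter_congr fun p hp => ?_
    have h := ((condInd_periodic hR hp).of_dvd (Finset.dvd_prod_of_mem (fun q => q) hp)) m
    unfold condInd at h
    by_cases h1 : R p m <;> by_cases h2 : R p (m + ∏ p ∈ B, p) <;> simp_all
  simp only [this]

lemma hasMean_condInd
    (hB : ∀ p ∈ B, p.Prime)
    (hR : ∀ p ∈ B, ∀ m, R p (m + p) ↔ R p m)
    {p : ℕ} (hp : p ∈ B) : HasMean (condInd R p) (condDensity R p) :=
  (condInd_periodic hR hp).hasMean (hB p hp).pos

lemma condDensity_nonneg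
    (hB : ∀ p ∈ B, p.Prime)
    (hR : ∀ p ∈ B, ∀ m, R p (m + p) ↔ R p m)
    {p : ℕ} (hp : p ∈ B) : 0 ≤ condDensity R p :=
  (hasMean_condInd hB hR hp).nonneg (condInd_nonneg R p)

lemma hasMean_choose_hits
    (hB : ∀ p ∈ B, p.Prime)
    (hR : ∀ p ∈ B, ∀ m, R p (m + p) ↔ R p m)
    (s : ℕ) :
    HasMean (fun m => ((hits R B m).choose s : ℝ)) (elemSym (condDensity R) B s) := by
  refine HasMean.congr (HasMean.sum fun T hT => ?_) (choose_hits s)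
  have hT' := (Finset.mem_powersetCard.1 hT).1
  exact HasMean.prod_of_coprime (Q := fun p => p) (fun p hp => (hB p (hT' hp)).pos)
    (pairwise_coprime_of_primes fun p hp => hB p (hT' hp))
    (fun p hp => condInd_periodic hR (hT' hp)) (fun p hp => hasMean_condInd hB hR (hT' hp))

lemma hasMean_hits_eq_zero
    (hB : ∀ p ∈ B, p.Prime)
    (hR : ∀ p ∈ B, ∀ m, R p (m + p) ↔ R p m)
    :
    HasMean (fun m => if hits R B m = 0 then (1 : ℝ) else 0)
      (∏ p ∈ B, (1 - condDensity R p)) := by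
  refine HasMean.congr ?_ ite_hits_eq_prod
  refine HasMean.prod_of_coprime (Q := fun p => p) (fun p hp => (hB p hp).pos)
    (pairwise_coprime_of_primes hB) (fun p hp m => ?_)
    (fun p hp => (HasMean.const 1).sub (hasMean_condInd hB hR hp))
  simp only [condInd_periodic hR hp m]

lemma exists_hasMean_bonferroni
    (hB : ∀ p ∈ B, p.Prime)
    (hR : ∀ p ∈ B, ∀ m, R p (m + p) ↔ R p m)
    (r : ℕ) :
    ∃ μ, HasMean (fun m => bonferroni r (hits R B m)) μ ∧ ∏ p ∈ B, (1 - condDensity R p) ≤ μ ∧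
      μ ≤ ∏ p ∈ B, (1 - condDensity R p) + elemSym (condDensity R) B (2 * r + 1) := by
  have h : HasMean (fun m => bonferroni r (hits R B m))
      (∑ i ∈ Finset.range (2 * r + 1), (-1) ^ i * elemSym (condDensity R) B i) :=
    HasMean.sum fun i _ => (hasMean_choose_hits hB hR i).const_mul _
  refine ⟨_, h, (hasMean_hits_eq_zero hB hR).mono h fun m => ?_,
    h.mono ((hasMean_hits_eq_zero hB hR).add (hasMean_choose_hits hB hR (2 * r + 1))) fun m => ?_⟩
  · split_ifs with h0
    · rw [h0, bonferroni_zero]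
    · exact bonferroni_nonneg _ _
  · split_ifs with h0
    · rw [h0, bonferroni_zero]; simp
    · rw [zero_add]; exact bonferroni_le_choose r h0

lemma classNormLE_choose_hits
    (hB : ∀ p ∈ B, p.Prime)
    (hR : ∀ p ∈ B, ∀ m, R p (m + p) ↔ R p m)
    (s : ℕ) :
    ClassNormLE (fun m => ((hits R B m).choose s : ℝ)) ((∑ p ∈ B, (p : ℝ)) ^ s) := by
  refine ClassNormLE.mono ?_ (elemSym_le_sum_pow (x := fun p => (p : ℝ)) (by simp) s)
  refine (ClassNormLE.sum fun T hT => ClassNormLE.prod fun p hp => ?_).congr (choose_hits s)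
  have hp' := (Finset.mem_powersetCard.1 hT).1 hp
  refine ClassNormLE.of_periodic (hB p hp').pos (condInd_periodic hR hp') fun m => ?_
  simp only [condInd]
  split_ifs <;> simp

lemma classNormLE_bonferroni
    (hB : ∀ p ∈ B, p.Prime)
    (hR : ∀ p ∈ B, ∀ m, R p (m + p) ↔ R p m)
    (r : ℕ) :
    ClassNormLE (fun m => bonferroni r (hits R B m))
      (∑ i ∈ Finset.range (2 * r + 1), (∑ p ∈ B, (p : ℝ)) ^ i) := by
  unfold bonferroni
  refine ClassNormLE.sum fun i _ => ?_
  exact ((classNormLE_choose_hits hB hR i).smul ((-1) ^ i)).congr_right (by simp)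

end Block

/-! ### Brun's sieve over several blocks of primes -/

/-- Removing the prime divisors of `d` from `B` costs a factor at most `10 / 9` per prime. -/
lemma prod_filter_not_dvd_le {B : Finset ℕ} {x : ℕ → ℝ} (d : ℕ)
    (hx : ∀ p ∈ B, x p ≤ 1 / 10) :
    ∏ p ∈ B.filter (fun p => ¬ p ∣ d), (1 - x p) ≤
      (∏ p ∈ B, (1 - x p)) * (10 / 9) ^ (B.filter (fun p => p ∣ d)).card := by
  rw [← Finset.prod_filter_mul_prod_filter_not B (fun p => p ∣ d), mul_right_comm,
    ← Finset.prod_const, ← Finset.prod_mul_distrib]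
  refine le_mul_of_one_le_left (Finset.prod_nonneg fun p hp => ?_) ?_
  · linarith [hx p (Finset.mem_filter.1 hp).1]
  · calc (1 : ℝ) = ∏ p ∈ B.filter (fun p => p ∣ d), (1 : ℝ) := by simp
      _ ≤ _ := Finset.prod_le_prod (fun _ _ => zero_le_one) fun p hp => by
        linarith [hx p (Finset.mem_filter.1 hp).1]

lemma sum_card_filter_dvd_le {ι : Type*} {s : Finset ι} {B : ι → Finset ℕ}
    (hB : ∀ i ∈ s, ∀ p ∈ B i, p.Prime) (hdisj : (s : Set ι).PairwiseDisjoint B) {d : ℕ}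
    (hd : d ≠ 0) :
    ∑ i ∈ s, ((B i).filter (fun p => p ∣ d)).card ≤ ArithmeticFunction.cardFactors d := by
  classical
  rw [← Finset.card_biUnion]
  · calc _ ≤ d.primeFactors.card := by
          refine Finset.card_le_card fun p hp => ?_
          obtain ⟨i, hi, hp⟩ := Finset.mem_biUnion.1 hp
          obtain ⟨hp, hpd⟩ := Finset.mem_filter.1 hp
          exact Nat.mem_primeFactors.2 ⟨hB i hi p hp, hpd, hd⟩
      _ ≤ d.primeFactorsList.length := by
          rw [Nat.primeFactors]
          exact List.toFinset_card_le _
      _ = _ := ArithmeticFunction.cardFactors_apply.symm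
  · intro i hi j hj hij
    exact (hdisj hi hj hij).mono (Finset.filter_subset _ _) (Finset.filter_subset _ _)

section Sieve

variable {ι : Type*} {s : Finset ι} {B : ι → Finset ℕ} {R : ℕ → ℕ → Prop}

lemma pairwise_coprime_prod_of_disjoint (hB : ∀ i ∈ s, ∀ p ∈ B i, p.Prime)
    (hdisj : (s : Set ι).PairwiseDisjoint B) :
    (s : Set ι).Pairwise fun i j => (∏ p ∈ B i, p).Coprime (∏ p ∈ B j, p) := by
  intro i hi j hj hij
  refine Nat.Coprime.prod_left fun p hp => Nat.Coprime.prod_right fun q hq => ?_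
  refine (Nat.coprime_primes (hB i hi p hp) (hB j hj q hq)).2 ?_
  rintro rfl
  exact Finset.disjoint_left.1 (hdisj hi hj hij) hp hq

lemma hasMean_prod_hits (hB : ∀ i ∈ s, ∀ p ∈ B i, p.Prime)
    (hdisj : (s : Set ι).PairwiseDisjoint B)
    (hR : ∀ i ∈ s, ∀ p ∈ B i, ∀ m, R p (m + p) ↔ R p m) {f : ι → ℕ → ℝ} {μ : ι → ℝ}
    (h : ∀ i ∈ s, HasMean (fun m => f i (hits R (B i) m)) (μ i)) :
    HasMean (fun m => ∏ i ∈ s, f i (hits R (B i) m)) (∏ i ∈ s, μ i) :=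
  HasMean.prod_of_coprime (Q := fun i => ∏ p ∈ B i, p)
    (fun i hi => Finset.prod_pos fun p hp => (hB i hi p hp).pos)
    (pairwise_coprime_prod_of_disjoint hB hdisj) (fun i hi => hits_periodic (hR i hi) (f i)) h

/-- The mean of the sieve weight over a residue class mod `d`. If no element of that class
satisfies `R p` for a prime `p ∣ d`, these primes drop out of the weight, which becomes
independent of the class. -/
lemma exists_hasMean_weight_mul_classInd {r : ι → ℕ} {ε : ι → ℝ} {d a : ℕ}
    (hB : ∀ i ∈ s, ∀ p ∈ B i, p.Prime) (hdisj : (s : Set ι).PairwiseDisjoint B)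
    (hR : ∀ i ∈ s, ∀ p ∈ B i, ∀ m, R p (m + p) ↔ R p m)
    (hx : ∀ i ∈ s, ∀ p ∈ B i, condDensity R p ≤ 1 / 10)
    (hε : ∀ i ∈ s, elemSym (condDensity R) (B i) (2 * r i + 1) ≤
      ε i * ∏ p ∈ B i, (1 - condDensity R p))
    (hd : d ≠ 0) (hcompat : ∀ i ∈ s, ∀ p ∈ B i, p ∣ d → ∀ m, m ≡ a [MOD d] → ¬ R p m) :
    ∃ μ, HasMean (fun m => (∏ i ∈ s, bonferroni (r i) (hits R (B i) m)) * classInd d a m) μ ∧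
      μ ≤ (∏ i ∈ s, ∏ p ∈ B i, (1 - condDensity R p)) * (∏ i ∈ s, (1 + ε i)) *
        ((10 / 9) ^ ArithmeticFunction.cardFactors d / d) := by
  set A : ι → Finset ℕ := fun i => (B i).filter (fun p => ¬ p ∣ d) with hA
  have hAB : ∀ i, A i ⊆ B i := fun i => Finset.filter_subset _ _
  have hAp : ∀ i ∈ s, ∀ p ∈ A i, p.Prime := fun i hi p hp => hB i hi p (hAB i hp)
  have hAR : ∀ i ∈ s, ∀ p ∈ A i, ∀ m, R p (m + p) ↔ R p m :=
    fun i hi p hp => hR i hi p (hAB i hp)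
  have hAdisj : (s : Set ι).PairwiseDisjoint A :=
    fun i hi j hj hij => (hdisj hi hj hij).mono (hAB i) (hAB j)
  have hd' : 0 < d := Nat.pos_of_ne_zero hd
  set V : ι → ℝ := fun i => ∏ p ∈ B i, (1 - condDensity R p) with hV
  have hx0 : ∀ i ∈ s, ∀ p ∈ B i, 0 ≤ condDensity R p :=
    fun i hi p hp => condDensity_nonneg (hB i hi) (hR i hi) hp
  have hVpos : ∀ i ∈ s, 0 < V i := fun i hi =>
    Finset.prod_pos fun p hp => by linarith [hx i hi p hp]
  have hεnn : ∀ i ∈ s, 0 ≤ ε i := fun i hi => by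
    have := (elemSym_nonneg (hx0 i hi) (2 * r i + 1)).trans (hε i hi)
    exact nonneg_of_mul_nonneg_left this (hVpos i hi)
  have hμ : ∀ i : ι, ∃ μ, i ∈ s → HasMean (fun m => bonferroni (r i) (hits R (A i) m)) μ ∧ 0 ≤ μ ∧
      μ ≤ V i * (1 + ε i) * (10 / 9) ^ ((B i).filter (fun p => p ∣ d)).card := by
    intro i
    by_cases hi : i ∈ s
    swap
    · exact ⟨0, fun h => absurd h hi⟩
    obtain ⟨μ, h1, -, h3⟩ := exists_hasMean_bonferroni (hAp i hi) (hAR i hi) (r i)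
    refine ⟨μ, fun _ => ⟨h1, h1.nonneg fun m => bonferroni_nonneg _ _, h3.trans ?_⟩⟩
    have h4 := prod_filter_not_dvd_le d (hx i hi)
    have h5 := (elemSym_mono (hAB i) (hx0 i hi) (2 * r i + 1)).trans (hε i hi)
    have h6 : (1 : ℝ) ≤ (10 / 9) ^ ((B i).filter (fun p => p ∣ d)).card :=
      one_le_pow₀ (by norm_num)
    have h7 : 0 ≤ ε i * V i := mul_nonneg (hεnn i hi) (hVpos i hi).le
    have h8 := mul_le_mul_of_nonneg_left h6 h7
    simp only [hV] at h8 ⊢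
    linarith
  choose μ hμ using hμ
  have hw := hasMean_prod_hits (f := fun i => bonferroni (r i)) hAp hAdisj hAR
    (fun i hi => (hμ i hi).1)
  have hcop : (∏ i ∈ s, ∏ p ∈ A i, p).Coprime d := by
    refine Nat.Coprime.prod_left fun i hi => Nat.Coprime.prod_left fun p hp => ?_
    exact ((hAp i hi p hp).coprime_iff_not_dvd).2 (Finset.mem_filter.1 hp).2
  have hprod := HasMean.mul_of_coprime
    (Finset.prod_pos fun i hi => Finset.prod_pos fun p hp => (hAp i hi p hp).pos) hd' hcop
    (Function.Periodic.finset_prod fun i hi => hits_periodic (hAR i hi) (bonferroni (r i)))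
    (G := fun m => classInd d a m) (fun m => by
      by_cases h : m % d = a % d <;> simp [classInd, Nat.ModEq, h])
    hw (HasMean.residueClass hd' a)
  refine ⟨_, hprod.congr fun m => ?_, ?_⟩
  · by_cases hm : m ≡ a [MOD d]
    · congr 1
      refine Finset.prod_congr rfl fun i hi => ?_
      congr 1
      unfold hits
      congr 1
      ext p
      simp only [hA, Finset.mem_filter]
      exact ⟨fun ⟨h1, h2⟩ => ⟨⟨h1, fun h => hcompat i hi p h1 h m hm h2⟩, h2⟩,
        fun ⟨h1, h2⟩ => ⟨h1.1, h2⟩⟩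
    · simp [classInd, hm]
  · have hle : ∏ i ∈ s, μ i ≤ (∏ i ∈ s, V i) * (∏ i ∈ s, (1 + ε i)) *
        (10 / 9) ^ ArithmeticFunction.cardFactors d := by
     calc ∏ i ∈ s, μ i
        ≤ ∏ i ∈ s, (V i * (1 + ε i) * (10 / 9) ^ ((B i).filter (fun p => p ∣ d)).card) :=
          Finset.prod_le_prod (fun i hi => (hμ i hi).2.1) fun i hi => (hμ i hi).2.2
      _ = (∏ i ∈ s, V i) * (∏ i ∈ s, (1 + ε i)) *
            (10 / 9) ^ (∑ i ∈ s, ((B i).filter (fun p => p ∣ d)).card) := by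
          rw [Finset.prod_mul_distrib, Finset.prod_mul_distrib, Finset.prod_pow_eq_pow_sum]
      _ ≤ _ := by
          refine mul_le_mul_of_nonneg_left
            (pow_le_pow_right₀ (by norm_num) (sum_card_filter_dvd_le hB hdisj hd)) ?_
          exact mul_nonneg (Finset.prod_nonneg fun i hi => (hVpos i hi).le)
            (Finset.prod_nonneg fun i hi => by linarith [hεnn i hi])
    rw [mul_one_div, mul_div_assoc']
    exact div_le_div_of_nonneg_right hle (Nat.cast_nonneg d)

/-- The sieve: some `m < X` satisfies none of the conditions `R p` and lies in none of the residue
classes `a e` mod `d e`, provided that the Bonferroni truncation errors `ε i` and the weighted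
densities of these classes have small sums, and that `X` is large in terms of the density of the
sifted set and of the norms `N i` of the weights. -/
theorem exists_sifted {κ : Type*} {r : ι → ℕ} {ε N : ι → ℝ} {E : Finset κ} {d a : κ → ℕ}
    (hB : ∀ i ∈ s, ∀ p ∈ B i, p.Prime) (hdisj : (s : Set ι).PairwiseDisjoint B)
    (hR : ∀ i ∈ s, ∀ p ∈ B i, ∀ m, R p (m + p) ↔ R p m)
    (hx : ∀ i ∈ s, ∀ p ∈ B i, condDensity R p ≤ 1 / 10)
    (hε : ∀ i ∈ s, elemSym (condDensity R) (B i) (2 * r i + 1) ≤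
      ε i * ∏ p ∈ B i, (1 - condDensity R p))
    (hεsum : ∑ i ∈ s, ε i ≤ 1 / 8)
    (hN : ∀ i ∈ s, ∑ j ∈ Finset.range (2 * r i + 2), (∑ p ∈ B i, (p : ℝ)) ^ j ≤ N i)
    (hd : ∀ e ∈ E, d e ≠ 0)
    (hcompat : ∀ e ∈ E, ∀ i ∈ s, ∀ p ∈ B i, p ∣ d e → ∀ m, m ≡ a e [MOD d e] → ¬ R p m)
    (hsum : ∑ e ∈ E, ((10 / 9 : ℝ) ^ ArithmeticFunction.cardFactors (d e) / d e) ≤ 1 / 8)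
    {X : ℕ} (hX : (∏ i ∈ s, N i) * (1 + s.card + E.card) <
      X * ((∏ i ∈ s, ∏ p ∈ B i, (1 - condDensity R p)) / 2)) :
    ∃ m < X, (∀ i ∈ s, ∀ p ∈ B i, ¬ R p m) ∧ ∀ e ∈ E, ¬ m ≡ a e [MOD d e] := by
  classical
  set V : ι → ℝ := fun i => ∏ p ∈ B i, (1 - condDensity R p) with hV
  have hx0 : ∀ i ∈ s, ∀ p ∈ B i, 0 ≤ condDensity R p :=
    fun i hi p hp => condDensity_nonneg (hB i hi) (hR i hi) hp
  have hVpos : ∀ i ∈ s, 0 < V i := fun i hi =>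
    Finset.prod_pos fun p hp => by linarith [hx i hi p hp]
  have hVV : 0 < ∏ i ∈ s, V i := Finset.prod_pos hVpos
  have hεnn : ∀ i ∈ s, 0 ≤ ε i := fun i hi => by
    have := (elemSym_nonneg (hx0 i hi) (2 * r i + 1)).trans (hε i hi)
    exact nonneg_of_mul_nonneg_left this (hVpos i hi)
  have hεprod : ∏ i ∈ s, (1 + ε i) ≤ 2 := by
    calc ∏ i ∈ s, (1 + ε i) ≤ ∏ i ∈ s, Real.exp (ε i) :=
          Finset.prod_le_prod (fun i hi => by linarith [hεnn i hi]) fun i _ => by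
            linarith [Real.add_one_le_exp (ε i)]
      _ = Real.exp (∑ i ∈ s, ε i) := (Real.exp_sum _ _).symm
      _ ≤ Real.exp (Real.log 2) := Real.exp_le_exp.2 (by linarith [Real.log_two_gt_d9])
      _ = 2 := Real.exp_log (by norm_num)
  set b : ι → ℕ → ℝ := fun i m => bonferroni (r i) (hits R (B i) m) with hb
  set c : ι → ℕ → ℝ := fun i m => ((hits R (B i) m).choose (2 * r i + 1) : ℝ) with hc
  have hbnn : ∀ i m, 0 ≤ b i m := fun i m => bonferroni_nonneg _ _
  have hcnn : ∀ i m, 0 ≤ c i m := fun i m => Nat.cast_nonneg _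
  -- mean values of the weight and of the two kinds of exceptional contributions to it
  obtain ⟨β, hβ⟩ : ∃ β : ι → ℝ, ∀ i ∈ s, HasMean (b i) (β i) ∧ V i ≤ β i ∧
      β i ≤ V i * (1 + ε i) := by
    have : ∀ i : ι, ∃ β, i ∈ s → HasMean (b i) β ∧ V i ≤ β ∧ β ≤ V i * (1 + ε i) := by
      intro i
      by_cases hi : i ∈ s
      · obtain ⟨μ, h1, h2, h3⟩ := exists_hasMean_bonferroni (hB i hi) (hR i hi) (r i)
        refine ⟨μ, fun _ => ⟨h1, h2, h3.trans ?_⟩⟩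
        have := hε i hi
        simp only [hV]
        linarith
      · exact ⟨0, fun h => absurd h hi⟩
    choose β hβ using this
    exact ⟨β, hβ⟩
  have hwmean : HasMean (fun m => ∏ i ∈ s, b i m) (∏ i ∈ s, β i) :=
    hasMean_prod_hits (f := fun i => bonferroni (r i)) hB hdisj hR fun i hi => (hβ i hi).1
  have hjmean : ∀ j ∈ s, HasMean (fun m => c j m * ∏ i ∈ s.erase j, b i m)
      (elemSym (condDensity R) (B j) (2 * r j + 1) * ∏ i ∈ s.erase j, β i) := by
    intro j hj
    have hne : ∀ i ∈ s.erase j, i ≠ j := fun i hi => (Finset.mem_erase.1 hi).1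
    have h := hasMean_prod_hits (f := fun i a => if i = j then (a.choose (2 * r i + 1) : ℝ)
      else bonferroni (r i) a) (μ := fun i => if i = j then
      elemSym (condDensity R) (B i) (2 * r i + 1) else β i) hB hdisj hR (fun i hi => by
        by_cases hij : i = j
        · simpa only [hij, if_true] using hasMean_choose_hits (hB j hj) (hR j hj) _
        · simpa only [hij, if_false] using (hβ i hi).1)
    rw [← Finset.mul_prod_erase s _ hj, if_pos rfl,
      Finset.prod_congr rfl fun i hi => if_neg (hne i hi)] at h
    refine h.congr fun m => ?_
    rw [← Finset.mul_prod_erase s _ hj, if_pos rfl,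
      Finset.prod_congr rfl fun i hi => if_neg (hne i hi)]
  obtain ⟨ν, hν⟩ : ∃ ν : κ → ℝ, ∀ e ∈ E,
      HasMean (fun m => (∏ i ∈ s, b i m) * classInd (d e) (a e) m) (ν e) ∧
      ν e ≤ (∏ i ∈ s, V i) * (∏ i ∈ s, (1 + ε i)) *
        ((10 / 9) ^ ArithmeticFunction.cardFactors (d e) / d e) := by
    have : ∀ e : κ, ∃ ν, e ∈ E →
        HasMean (fun m => (∏ i ∈ s, b i m) * classInd (d e) (a e) m) ν ∧
        ν ≤ (∏ i ∈ s, V i) * (∏ i ∈ s, (1 + ε i)) *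
          ((10 / 9) ^ ArithmeticFunction.cardFactors (d e) / d e) := by
      intro e
      by_cases he : e ∈ E
      · obtain ⟨ν, h⟩ := exists_hasMean_weight_mul_classInd hB hdisj hR hx hε (hd e he)
          (hcompat e he)
        exact ⟨ν, fun _ => h⟩
      · exact ⟨0, fun h => absurd h he⟩
    choose ν hν using this
    exact ⟨ν, hν⟩
  set F : ℕ → ℝ := fun m => ∏ i ∈ s, b i m - ∑ j ∈ s, c j m * ∏ i ∈ s.erase j, b i m -
    ∑ e ∈ E, (∏ i ∈ s, b i m) * classInd (d e) (a e) m with hF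
  have hFmean := (hwmean.sub (HasMean.sum hjmean)).sub (HasMean.sum fun e he => (hν e he).1)
  set M : ℝ := ∏ i ∈ s, β i - ∑ j ∈ s, elemSym (condDensity R) (B j) (2 * r j + 1) *
    ∏ i ∈ s.erase j, β i - ∑ e ∈ E, ν e with hM
  have hMge : (∏ i ∈ s, V i) / 2 ≤ M := by
    have h1 : ∏ i ∈ s, V i ≤ ∏ i ∈ s, β i :=
      Finset.prod_le_prod (fun i hi => (hVpos i hi).le) fun i hi => (hβ i hi).2.1
    have h2 : ∀ j ∈ s, elemSym (condDensity R) (B j) (2 * r j + 1) * ∏ i ∈ s.erase j, β i ≤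
        ε j * ((∏ i ∈ s, V i) * 2) := by
      intro j hj
      have hβ0 : ∀ i ∈ s, 0 ≤ β i := fun i hi => (hVpos i hi).le.trans (hβ i hi).2.1
      calc _ ≤ ε j * V j * ∏ i ∈ s.erase j, β i :=
            mul_le_mul_of_nonneg_right (hε j hj)
              (Finset.prod_nonneg fun i hi => hβ0 i (Finset.mem_of_mem_erase hi))
        _ = ε j * (V j * ∏ i ∈ s.erase j, β i) := by ring
        _ ≤ ε j * (β j * ∏ i ∈ s.erase j, β i) := by
            refine mul_le_mul_of_nonneg_left (mul_le_mul_of_nonneg_right (hβ j hj).2.1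
              (Finset.prod_nonneg fun i hi => hβ0 i (Finset.mem_of_mem_erase hi))) (hεnn j hj)
        _ = ε j * ∏ i ∈ s, β i := by rw [Finset.mul_prod_erase s β hj]
        _ ≤ ε j * ∏ i ∈ s, (V i * (1 + ε i)) := by
            refine mul_le_mul_of_nonneg_left (Finset.prod_le_prod hβ0 fun i hi => (hβ i hi).2.2)
              (hεnn j hj)
        _ ≤ _ := by
            rw [Finset.prod_mul_distrib]
            exact mul_le_mul_of_nonneg_left (mul_le_mul_of_nonneg_left hεprod hVV.le) (hεnn j hj)
    have h3 : ∀ e ∈ E, ν e ≤ ((∏ i ∈ s, V i) * 2) *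
        ((10 / 9) ^ ArithmeticFunction.cardFactors (d e) / d e) := fun e he =>
      (hν e he).2.trans (mul_le_mul_of_nonneg_right (mul_le_mul_of_nonneg_left hεprod hVV.le)
        (by positivity))
    have h4 := Finset.sum_le_sum h2
    have h5 := Finset.sum_le_sum h3
    rw [← Finset.sum_mul] at h4
    rw [← Finset.mul_sum] at h5
    have h6 := mul_le_mul_of_nonneg_right hεsum (by positivity : 0 ≤ (∏ i ∈ s, V i) * 2)
    have h7 := mul_le_mul_of_nonneg_left hsum (by positivity : 0 ≤ (∏ i ∈ s, V i) * 2)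
    linarith
  have hσ : ∀ i, 0 ≤ ∑ p ∈ B i, (p : ℝ) := fun i => Finset.sum_nonneg fun _ _ => Nat.cast_nonneg _
  have hNb : ∀ i ∈ s, ClassNormLE (b i) (N i) := fun i hi =>
    (classNormLE_bonferroni (hB i hi) (hR i hi) (r i)).mono (le_trans (by
      rw [Finset.sum_range_succ _ (2 * r i + 1)]
      exact le_add_of_nonneg_right (pow_nonneg (hσ i) _)) (hN i hi))
  have hNc : ∀ i ∈ s, ClassNormLE (c i) (N i) := fun i hi =>
    (classNormLE_choose_hits (hB i hi) (hR i hi) (2 * r i + 1)).mono (le_trans (by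
      rw [Finset.sum_range_succ _ (2 * r i + 1)]
      exact le_add_of_nonneg_left (Finset.sum_nonneg fun _ _ => pow_nonneg (hσ i) _)) (hN i hi))
  have hwnorm : ClassNormLE (fun m => ∏ i ∈ s, b i m) (∏ i ∈ s, N i) := ClassNormLE.prod hNb
  have hjnorm : ∀ j ∈ s, ClassNormLE (fun m => c j m * ∏ i ∈ s.erase j, b i m)
      (∏ i ∈ s, N i) := fun j hj =>
    ((hNc j hj).mul (ClassNormLE.prod fun i hi => hNb i (Finset.mem_of_mem_erase hi))).congr_right
      (Finset.mul_prod_erase s N hj).symm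
  have henorm : ∀ e ∈ E, ClassNormLE (fun m => (∏ i ∈ s, b i m) * classInd (d e) (a e) m)
      (∏ i ∈ s, N i) := fun e he =>
    (hwnorm.mul (ClassNormLE.ind (d e) (a e) (Nat.pos_of_ne_zero (hd e he)))).congr_right
      (mul_one _).symm
  have hFnorm : ClassNormLE F ((∏ i ∈ s, N i) * (1 + s.card + E.card)) := by
    refine ((hwnorm.sub (ClassNormLE.sum hjnorm)).sub (ClassNormLE.sum henorm)).congr_right ?_
    simp only [Finset.sum_const, nsmul_eq_mul]
    ring
  by_contra hcon
  push Not at hcon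
  have hFle : ∀ m ∈ Finset.range X, F m ≤ 0 := by
    intro m hm
    have hw0 : 0 ≤ ∏ i ∈ s, b i m := Finset.prod_nonneg fun i _ => hbnn i m
    have ht : ∀ j ∈ s, 0 ≤ c j m * ∏ i ∈ s.erase j, b i m := fun j _ =>
      mul_nonneg (hcnn j m) (Finset.prod_nonneg fun i _ => hbnn i m)
    have hu : ∀ e ∈ E, 0 ≤ (∏ i ∈ s, b i m) * classInd (d e) (a e) m := fun e _ =>
      mul_nonneg hw0 (classInd_nonneg _ _ _)
    by_cases hz : ∀ i ∈ s, ∀ p ∈ B i, ¬ R p m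
    · obtain ⟨e, he, hme⟩ := hcon m (Finset.mem_range.1 hm) hz
      have h1 := Finset.single_le_sum hu he
      have h2 := Finset.sum_nonneg ht
      rw [classInd, if_pos hme, mul_one] at h1
      simp only [hF]
      linarith
    · push Not at hz
      obtain ⟨j, hj, p, hp, hRp⟩ := hz
      have hne : hits R (B j) m ≠ 0 := fun h => hits_eq_zero.1 h p hp hRp
      have h1 := Finset.single_le_sum ht hj
      have h2 := Finset.sum_nonneg hu
      have h3 : ∏ i ∈ s, b i m ≤ c j m * ∏ i ∈ s.erase j, b i m := by
        rw [← Finset.mul_prod_erase s _ hj]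
        exact mul_le_mul_of_nonneg_right (bonferroni_le_choose _ hne)
          (Finset.prod_nonneg fun i _ => hbnn i m)
      simp only [hF]
      linarith
  have h1 := (abs_le.1 (hFnorm.abs_sum_sub_le hFmean X)).1
  have h2 := Finset.sum_nonpos hFle
  have h3 := mul_le_mul_of_nonneg_left hMge (Nat.cast_nonneg (α := ℝ) X)
  linarith

end Sieve

/-! ### Sums of reciprocals of primes -/

/-- The primes in `(2 ^ a, 2 ^ (a + n)]`. -/
def dyadicPrimes (a n : ℕ) : Finset ℕ := (Finset.Ioc (2 ^ a) (2 ^ (a + n))).filter Nat.Prime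

lemma sum_inv_dyadicPrimes_one_le {a : ℕ} (ha : 0 < a) :
    ∑ p ∈ dyadicPrimes a 1, (1 / p : ℝ) ≤ 4 / a := by
  set S := dyadicPrimes a 1 with hS
  have hmem : ∀ p ∈ S, 2 ^ a < p ∧ p ≤ 2 ^ (a + 1) ∧ p.Prime := fun p hp => by
    simpa [hS, dyadicPrimes, and_assoc] using hp
  have h1 : (2 ^ a) ^ S.card ≤ 4 ^ 2 ^ (a + 1) := by
    calc (2 ^ a) ^ S.card ≤ ∏ p ∈ S, p := by
          rw [← Finset.prod_const]
          exact Finset.prod_le_prod' fun p hp => (hmem p hp).1.le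
      _ ≤ primorial (2 ^ (a + 1)) := by
          rw [primorial]
          refine Finset.prod_le_prod_of_subset_of_one_le' (fun p hp => ?_) fun p hp _ => ?_
          · have := hmem p hp
            simp [this]
          · exact (Finset.mem_filter.1 hp).2.one_lt.le
      _ ≤ _ := primorial_le_four_pow _
  have h2 : a * S.card ≤ 4 * 2 ^ a := by
    rw [show (4 : ℕ) = 2 ^ 2 by norm_num, ← pow_mul, ← pow_mul] at h1
    have := (Nat.pow_le_pow_iff_right (by norm_num)).1 h1
    rw [pow_succ] at this
    omega
  have ha' : (0 : ℝ) < a := by exact_mod_cast ha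
  have h3 : (a : ℝ) * S.card ≤ 4 * 2 ^ a := by exact_mod_cast h2
  calc ∑ p ∈ S, (1 / p : ℝ) ≤ ∑ p ∈ S, (1 / 2 ^ a : ℝ) := by
        refine Finset.sum_le_sum fun p hp => one_div_le_one_div_of_le (by positivity) ?_
        exact_mod_cast (hmem p hp).1.le
    _ = S.card / 2 ^ a := by simp [div_eq_mul_inv]
    _ ≤ 4 / a := by
        rw [div_le_div_iff₀ (by positivity) ha']
        linarith

lemma sum_inv_dyadicPrimes_le {a : ℕ} (ha : 0 < a) (n : ℕ) :
    ∑ p ∈ dyadicPrimes a n, (1 / p : ℝ) ≤ n * (4 / a) := by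
  have ha' : (0 : ℝ) < a := by exact_mod_cast ha
  induction n with
  | zero => simp [dyadicPrimes]
  | succ n ih =>
    have hsub : dyadicPrimes a (n + 1) ⊆ dyadicPrimes a n ∪ dyadicPrimes (a + n) 1 := by
      intro p hp
      simp only [dyadicPrimes, Finset.mem_union, Finset.mem_filter, Finset.mem_Ioc] at hp ⊢
      rcases le_or_gt p (2 ^ (a + n)) with h | h
      · exact Or.inl ⟨⟨hp.1.1, h⟩, hp.2⟩
      · exact Or.inr ⟨⟨h, hp.1.2⟩, hp.2⟩
    have h1 : ∑ p ∈ dyadicPrimes a (n + 1), (1 / p : ℝ) ≤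
        ∑ p ∈ dyadicPrimes a n ∪ dyadicPrimes (a + n) 1, (1 / p : ℝ) :=
      Finset.sum_le_sum_of_subset_of_nonneg hsub fun _ _ _ => by positivity
    have h2 := Finset.sum_union_inter (s₁ := dyadicPrimes a n) (s₂ := dyadicPrimes (a + n) 1)
      (f := fun p => (1 / p : ℝ))
    have h3 : 0 ≤ ∑ p ∈ dyadicPrimes a n ∩ dyadicPrimes (a + n) 1, (1 / p : ℝ) :=
      Finset.sum_nonneg fun _ _ => by positivity
    have h4 := sum_inv_dyadicPrimes_one_le (a := a + n) (by omega)
    have h5 : (4 : ℝ) / ((a + n : ℕ) : ℝ) ≤ 4 / a := by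
      refine div_le_div_of_nonneg_left (by norm_num) ha' ?_
      push_cast
      linarith [Nat.cast_nonneg (α := ℝ) n]
    push_cast
    linarith

lemma sum_inv_primes_le (h : ℕ) :
    ∑ p ∈ (Finset.Icc 1 (2 ^ h)).filter Nat.Prime, (1 / p : ℝ) ≤ 1 + h := by
  have h1 := harmonic_le_one_add_log (2 ^ h)
  rw [harmonic_eq_sum_Icc] at h1
  push_cast at h1
  rw [Real.log_pow] at h1
  have h2 : ∑ p ∈ (Finset.Icc 1 (2 ^ h)).filter Nat.Prime, (1 / p : ℝ) ≤
      ∑ p ∈ (Finset.Icc 1 (2 ^ h) : Finset ℕ), (p : ℝ)⁻¹ := by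
    simp only [one_div]
    exact Finset.sum_le_sum_of_subset_of_nonneg (Finset.filter_subset _ _) fun _ _ _ => by
      positivity
  have h3 : (h : ℝ) * Real.log 2 ≤ h :=
    mul_le_of_le_one_right (Nat.cast_nonneg h) (by linarith [Real.log_two_lt_d9])
  linarith

/-! ### Integers with many prime factors -/

lemma pow_cardFactors_le {n : ℕ} (hn : n ≠ 0) : 2 ^ ArithmeticFunction.cardFactors n ≤ n := by
  rw [ArithmeticFunction.cardFactors_apply]
  conv_rhs => rw [← Nat.prod_primeFactorsList hn]
  exact List.pow_card_le_prod _ _ fun p hp => (Nat.prime_of_mem_primeFactorsList hp).two_le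

lemma cardDistinctFactors_le_cardFactors (n : ℕ) :
    ArithmeticFunction.cardDistinctFactors n ≤ ArithmeticFunction.cardFactors n := by
  rw [ArithmeticFunction.cardDistinctFactors_apply, ArithmeticFunction.cardFactors_apply]
  exact (List.dedup_sublist _).length_le

/-- If `n` has at least `r` prime factors with the property `P`, it has a divisor with exactly `r`
prime factors, all of which have this property. -/
lemma exists_dvd_cardFactors_eq {n r : ℕ} (hn : n ≠ 0) (P : ℕ → Prop) [DecidablePred P]
    (h : r ≤ (n.primeFactorsList.filter (fun p => P p)).length) :
    ∃ d, d ∣ n ∧ ArithmeticFunction.cardFactors d = r ∧ ∀ p, p.Prime → p ∣ d → P p := by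
  set l := (n.primeFactorsList.filter (fun p => P p)).take r with hl
  have hsub : l.Sublist (n.primeFactorsList.filter (fun p => P p)) := List.take_sublist _ _
  have hsub' : l.Sublist n.primeFactorsList := hsub.trans List.filter_sublist
  have hperm := Nat.primeFactorsList_unique (n := l.prod) (l := l) rfl
    fun p hp => Nat.prime_of_mem_primeFactorsList (hsub'.subset hp)
  refine ⟨l.prod, ?_, ?_, ?_⟩
  · conv_rhs => rw [← Nat.prod_primeFactorsList hn]
    exact hsub'.prod_dvd_prod
  · rw [ArithmeticFunction.cardFactors_apply, ← hperm.length_eq, hl, List.length_take]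
    exact min_eq_left h
  · intro p hp hpd
    have hne : l.prod ≠ 0 := by
      intro h0
      have h1 := hsub'.prod_dvd_prod
      rw [h0, Nat.prod_primeFactorsList hn] at h1
      exact hn (zero_dvd_iff.1 h1)
    have h1 : p ∈ l := hperm.mem_iff.2 ((Nat.mem_primeFactorsList hne).2 ⟨hp, hpd⟩)
    simpa using (List.mem_filter.1 (hsub.subset h1)).2

/-- An integer `n ≤ z ^ A` has at most `A * l` prime factors exceeding `z ^ (1 / l)`. -/
lemma length_filter_large_primes_le {n z l A : ℕ} (hn : n ≠ 0) (hz : 1 < z) (hnz : n ≤ z ^ A) :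
    (n.primeFactorsList.filter (fun p => ¬ p ^ l ≤ z)).length ≤ A * l := by
  set L := n.primeFactorsList.filter (fun p => ¬ p ^ l ≤ z) with hL
  have h1 : z ^ L.length ≤ L.prod ^ l := by
    have : ∀ L' : List ℕ, (∀ p ∈ L', z ≤ p ^ l) → z ^ L'.length ≤ L'.prod ^ l := by
      intro L' hL'
      induction L' with
      | nil => simp
      | cons p t ih =>
        rw [List.length_cons, List.prod_cons, mul_pow, pow_succ, mul_comm]
        exact Nat.mul_le_mul (hL' p (by simp)) (ih fun q hq => hL' q (by simp [hq]))
    refine this L fun p hp => ?_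
    have := (List.mem_filter.1 hp).2
    simp only [not_le, decide_eq_true_eq] at this
    exact this.le
  have h2 : L.prod ≤ n := by
    refine Nat.le_of_dvd (Nat.pos_of_ne_zero hn) ?_
    conv_rhs => rw [← Nat.prod_primeFactorsList hn]
    exact List.filter_sublist.prod_dvd_prod
  have h3 : z ^ L.length ≤ z ^ (A * l) := by
    rw [pow_mul]
    exact h1.trans (Nat.pow_le_pow_left (h2.trans hnz) l)
  exact (Nat.pow_le_pow_iff_right hz).1 h3

lemma pow_le_of_forall_prime_pow_le {d l z : ℕ} (hd : d ≠ 0)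
    (h : ∀ p, p.Prime → p ∣ d → p ^ l ≤ z) : d ^ l ≤ z ^ ArithmeticFunction.cardFactors d := by
  rw [ArithmeticFunction.cardFactors_apply]
  conv_lhs => rw [← Nat.prod_primeFactorsList hd]
  have : ∀ L : List ℕ, (∀ p ∈ L, p ^ l ≤ z) → L.prod ^ l ≤ z ^ L.length := by
    intro L hL
    induction L with
    | nil => simp
    | cons p t ih =>
      rw [List.length_cons, List.prod_cons, mul_pow, pow_succ, mul_comm]
      exact Nat.mul_le_mul (ih fun q hq => hL q (by simp [hq])) (hL p (by simp))
  exact this _ fun p hp => h p (Nat.prime_of_mem_primeFactorsList hp)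
    (Nat.dvd_of_mem_primeFactorsList hp)

/-- The completely multiplicative function `d ↦ (5 / 3) ^ Ω d / d`. -/
noncomputable def rankinWeight : ℕ →* ℝ where
  toFun d := (5 / 3) ^ ArithmeticFunction.cardFactors d / d
  map_one' := by simp
  map_mul' m n := by
    by_cases hm : m = 0
    · simp [hm]
    by_cases hn : n = 0
    · simp [hn]
    rw [ArithmeticFunction.cardFactors_mul hm hn, pow_add]
    push_cast
    field_simp

/-- Rankin's trick: the weighted sum of reciprocals of integers with exactly `r` prime factors, all
taken from `P`, decays geometrically in `r`. The Euler product of `rankinWeight` converges because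
`5 / 3 < 2`. -/
lemma sum_cardFactors_eq_le {P E : Finset ℕ} {r : ℕ} (hP : ∀ p ∈ P, p.Prime)
    (hE : ∀ d ∈ E, d ≠ 0 ∧ ArithmeticFunction.cardFactors d = r ∧ ∀ p, p.Prime → p ∣ d → p ∈ P) :
    ∑ d ∈ E, ((10 / 9 : ℝ) ^ ArithmeticFunction.cardFactors d / d) ≤
      (2 / 3) ^ r * Real.exp (10 * ∑ p ∈ P, (1 / p : ℝ)) := by
  have hwp : ∀ p : ℕ, p.Prime → rankinWeight p = (5 / 3) / p := fun p hp => by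
    simp [rankinWeight, ArithmeticFunction.cardFactors_apply_prime hp]
  have hle : ∀ p : ℕ, p.Prime → (5 / 3 : ℝ) / p ≤ 5 / 6 := fun p hp => by
    have h2 : (2 : ℝ) ≤ p := by exact_mod_cast hp.two_le
    rw [div_le_iff₀ (by linarith)]
    linarith
  have hnn : ∀ d, 0 ≤ rankinWeight d := fun d => by
    change (0 : ℝ) ≤ (5 / 3) ^ ArithmeticFunction.cardFactors d / d
    positivity
  obtain ⟨-, hsum⟩ := EulerProduct.summable_and_hasSum_factoredNumbers_prod_filter_prime_geometric
    (f := rankinWeight) (fun {p} hp => by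
      rw [Real.norm_of_nonneg (hnn p), hwp p hp]
      linarith [hle p hp]) P
  have hmem : ∀ d ∈ E, d ∈ Nat.factoredNumbers P := fun d hd => by
    rw [Nat.mem_factoredNumbers']
    exact fun p hp hpd => (hE d hd).2.2 p hp hpd
  have h1 : ∑ d ∈ E, rankinWeight d ≤ ∏ p ∈ P with p.Prime, (1 - rankinWeight p)⁻¹ := by
    have h2 := sum_le_hasSum (E.attach.map ⟨fun d => (⟨d.1, hmem d.1 d.2⟩ : Nat.factoredNumbers P),
      fun a b hab => Subtype.ext (by simpa using hab)⟩) (fun d _ => hnn d) hsum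
    rw [Finset.sum_map] at h2
    simpa using (Finset.sum_attach E fun d => rankinWeight d).symm.le.trans h2
  have h3 : ∏ p ∈ P with p.Prime, (1 - rankinWeight p)⁻¹ ≤
      Real.exp (10 * ∑ p ∈ P, (1 / p : ℝ)) := by
    rw [Finset.filter_true_of_mem hP, Finset.mul_sum, Real.exp_sum]
    refine Finset.prod_le_prod (fun p hp => ?_) fun p hp => ?_
    · rw [hwp p (hP p hp)]
      exact inv_nonneg.2 (by linarith [hle p (hP p hp)])
    · rw [hwp p (hP p hp)]
      have h4 := hle p (hP p hp)
      have h5 : (0 : ℝ) ≤ 5 / 3 / p := by positivity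
      have h6 : (10 : ℝ) * (1 / p) = 6 * (5 / 3 / p) := by ring
      rw [h6]
      refine le_trans ?_ (Real.add_one_le_exp _)
      rw [inv_le_iff_one_le_mul₀ (by linarith)]
      nlinarith
  have h7 : ∑ d ∈ E, ((10 / 9 : ℝ) ^ ArithmeticFunction.cardFactors d / d) =
      (2 / 3) ^ r * ∑ d ∈ E, rankinWeight d := by
    rw [Finset.mul_sum]
    refine Finset.sum_congr rfl fun d hd => ?_
    change _ = (2 / 3 : ℝ) ^ r * ((5 / 3) ^ ArithmeticFunction.cardFactors d / d)
    rw [(hE d hd).2.1, mul_div_assoc', ← mul_pow]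
    norm_num
  rw [h7]
  exact mul_le_mul_of_nonneg_left (h1.trans h3) (by positivity)

lemma exists_residue_iff {c d : ℕ} (hd : 0 < d) (hcd : c.Coprime d) (b : ℕ) :
    ∃ a, ∀ m, c * (m + 1) ≡ b [MOD d] ↔ m ≡ a [MOD d] := by
  obtain ⟨c', hc'⟩ : ∃ c', c * c' ≡ 1 [MOD d] := by
    obtain ⟨x, hx1, hx0⟩ := Nat.chineseRemainder hcd.symm 1 0
    obtain ⟨c', rfl⟩ := (Nat.modEq_zero_iff_dvd).1 hx0
    exact ⟨c', hx1⟩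
  -- the summand `d - 1` plays the role of `-1`
  refine ⟨c' * b + (d - 1), fun m => ?_⟩
  have h1 : c * (c' * b + (d - 1) + 1) ≡ b [MOD d] := by
    have : c * (c' * b + (d - 1) + 1) = c * c' * b + d * c := by
      obtain ⟨e, rfl⟩ := Nat.exists_eq_succ_of_ne_zero hd.ne'
      simp only [Nat.succ_eq_add_one, Nat.add_sub_cancel]
      ring
    rw [this]
    have h2 := (hc'.mul_right b).add_right (d * c)
    rw [one_mul] at h2
    exact h2.trans (by simp [Nat.ModEq])
  constructor
  · intro h
    have := Nat.ModEq.cancel_left_of_coprime (by simpa [Nat.coprime_comm] using hcd)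
      (h.trans h1.symm)
    exact Nat.ModEq.add_right_cancel' 1 this
  · intro h
    exact ((h.add_right 1).mul_left c).trans h1

/-! ### The sifted integers

For a parameter `J`, put `h = 2 * J`, `y = 2 ^ h`, `z = 2 ^ (h * 4 ^ J)`. -/

/-- The `i`-th block of primes: those in `(2 ^ (h * 4 ^ i), 2 ^ (h * 4 ^ (i + 1))]`. -/
def primeBlock (h i : ℕ) : Finset ℕ :=
  (Finset.Ioc (2 ^ (h * 4 ^ i)) (2 ^ (h * 4 ^ (i + 1)))).filter Nat.Prime

/-- The modulus `(y!) ^ 2`, where `y = 2 ^ h`. -/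
def modulus (h : ℕ) : ℕ := (2 ^ h).factorial ^ 2

/-- The candidates `n ≡ 1` modulo `modulus h`, indexed by `m`. -/
def candidate (h m : ℕ) : ℕ := 1 + modulus h * (m + 1)

/-- `p` lies in block `i` and divides `candidate h m - k` for some `k` in `[2, 2 ^ (J - i)]`. -/
def Excluded (J h p m : ℕ) : Prop :=
  ∃ i < J, p ∈ primeBlock h i ∧ ∃ k ∈ Finset.Icc 2 (2 ^ (J - i)), candidate h m ≡ k [MOD p]

lemma mem_primeBlock {h i p : ℕ} : p ∈ primeBlock h i ↔
    2 ^ (h * 4 ^ i) < p ∧ p ≤ 2 ^ (h * 4 ^ (i + 1)) ∧ p.Prime := by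
  simp [primeBlock, and_assoc]

lemma primeBlock_eq_of_mem {h i j p : ℕ} (hi : p ∈ primeBlock h i) (hj : p ∈ primeBlock h j) :
    i = j := by
  by_contra hne
  have key : ∀ {i j : ℕ}, p ∈ primeBlock h i → p ∈ primeBlock h j → ¬ i < j := by
    intro i j hi hj hij
    have h1 := (mem_primeBlock.1 hi).2.1
    have h2 := (mem_primeBlock.1 hj).1
    have h3 : 2 ^ (h * 4 ^ (i + 1)) ≤ 2 ^ (h * 4 ^ j) := by
      gcongr
      · norm_num
      · norm_num
      · exact hij
    omega
  rcases lt_or_gt_of_ne hne with h | h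
  · exact key hi hj h
  · exact key hj hi h

lemma exists_mem_primeBlock {J h p : ℕ} (hp : p.Prime) (h1 : 2 ^ h < p)
    (h2 : p ≤ 2 ^ (h * 4 ^ J)) : ∃ i < J, p ∈ primeBlock h i := by
  induction J with
  | zero => simp at h2; omega
  | succ J ih =>
    rcases le_or_gt p (2 ^ (h * 4 ^ J)) with h3 | h3
    · obtain ⟨i, hi, hi'⟩ := ih h3
      exact ⟨i, by omega, hi'⟩
    · exact ⟨J, by omega, mem_primeBlock.2 ⟨h3, h2, hp⟩⟩

lemma sum_inv_primeBlock_le {h : ℕ} (hh : 0 < h) (i : ℕ) :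
    ∑ p ∈ primeBlock h i, (1 / p : ℝ) ≤ 12 := by
  have h0 : 0 < h * 4 ^ i := by positivity
  have h1 := sum_inv_dyadicPrimes_le h0 (3 * (h * 4 ^ i))
  have h2 : primeBlock h i = dyadicPrimes (h * 4 ^ i) (3 * (h * 4 ^ i)) := by
    unfold primeBlock dyadicPrimes
    rw [show h * 4 ^ (i + 1) = h * 4 ^ i + 3 * (h * 4 ^ i) by ring]
  rw [h2]
  refine h1.trans (le_of_eq ?_)
  have : ((h * 4 ^ i : ℕ) : ℝ) ≠ 0 := by exact_mod_cast h0.ne'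
  push_cast at this ⊢
  field_simp
  norm_num

lemma sum_primeBlock_le (h i : ℕ) :
    ∑ p ∈ primeBlock h i, (p : ℝ) ≤ (2 ^ (h * 4 ^ (i + 1))) ^ 2 := by
  have h1 : ∑ p ∈ primeBlock h i, p ≤ (primeBlock h i).card * 2 ^ (h * 4 ^ (i + 1)) :=
    Finset.sum_le_card_nsmul _ _ _ fun p hp => (mem_primeBlock.1 hp).2.1
  have h2 : (primeBlock h i).card ≤ 2 ^ (h * 4 ^ (i + 1)) := by
    refine (Finset.card_filter_le _ _).trans ?_
    simp
  have h3 : ∑ p ∈ primeBlock h i, p ≤ (2 ^ (h * 4 ^ (i + 1))) ^ 2 := by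
    rw [sq]
    exact h1.trans (Nat.mul_le_mul_right _ h2)
  have h4 := (Nat.cast_le (α := ℝ)).2 h3
  push_cast at h4
  exact h4

lemma prime_coprime_modulus {h p : ℕ} (hp : p.Prime) (hlt : 2 ^ h < p) :
    (modulus h).Coprime p := by
  refine Nat.Coprime.symm ((hp.coprime_iff_not_dvd).2 fun hd => ?_)
  have := (hp.dvd_factorial).1 (hp.dvd_of_dvd_pow hd)
  omega

lemma lt_of_mem_primeBlock {h i p : ℕ} (hp : p ∈ primeBlock h i) : 2 ^ h < p := by
  refine lt_of_le_of_lt ?_ (mem_primeBlock.1 hp).1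
  exact Nat.pow_le_pow_right (by norm_num) (Nat.le_mul_of_pos_right h (by positivity))

lemma excluded_periodic (J h p m : ℕ) : Excluded J h p (m + p) ↔ Excluded J h p m := by
  have : candidate h (m + p) ≡ candidate h m [MOD p] := by
    unfold candidate
    rw [show 1 + modulus h * (m + p + 1) = 1 + modulus h * (m + 1) + modulus h * p by ring]
    simp [Nat.ModEq]
  unfold Excluded
  refine exists_congr fun i => and_congr_right fun _ => and_congr_right fun _ =>
    exists_congr fun k => and_congr_right fun _ => ?_
  exact ⟨fun h => this.symm.trans h, fun h => this.trans h⟩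

lemma condDensity_excluded_le {J h i p : ℕ} (hp : p ∈ primeBlock h i) :
    condDensity (Excluded J h) p ≤ 2 ^ (J - i) * (1 / p : ℝ) := by
  have hpp := (mem_primeBlock.1 hp).2.2
  have hres : ∀ k : ℕ, ∃ a, 1 ≤ k → ∀ m, candidate h m ≡ k [MOD p] ↔ m ≡ a [MOD p] := by
    intro k
    obtain ⟨a, ha⟩ := exists_residue_iff hpp.pos
      (prime_coprime_modulus hpp (lt_of_mem_primeBlock hp)) (k - 1)
    refine ⟨a, fun hk m => ?_⟩
    rw [← ha m]
    obtain ⟨k, rfl⟩ := Nat.exists_eq_add_of_le hk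
    simp only [candidate, Nat.add_sub_cancel_left]
    exact ⟨fun h => Nat.ModEq.add_left_cancel' 1 h, fun h => h.add_left 1⟩
  choose a ha using hres
  have h1 : HasMean (condInd (Excluded J h) p) (condDensity (Excluded J h) p) :=
    hasMean_condInd (B := {p}) (by simpa using hpp)
      (fun q _ m => excluded_periodic J h q m) (by simp)
  have h2 : HasMean (fun m => ∑ k ∈ Finset.Icc 2 (2 ^ (J - i)), classInd p (a k) m)
      (∑ k ∈ Finset.Icc 2 (2 ^ (J - i)), (1 / p : ℝ)) :=
    HasMean.sum fun k _ => HasMean.residueClass hpp.pos (a k)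
  refine (h1.mono h2 fun m => ?_).trans ?_
  · have hnn : ∀ k ∈ Finset.Icc 2 (2 ^ (J - i)), 0 ≤ classInd p (a k) m :=
      fun k _ => classInd_nonneg _ _ _
    unfold condInd
    split_ifs with hex
    · obtain ⟨i', _, hi', k, hk, hmod⟩ := hex
      rw [primeBlock_eq_of_mem hi' hp] at hk
      refine le_trans ?_ (Finset.single_le_sum hnn hk)
      rw [classInd, if_pos ((ha k (by linarith [(Finset.mem_Icc.1 hk).1]) m).1 hmod)]
    · exact Finset.sum_nonneg hnn
  · rw [Finset.sum_const, nsmul_eq_mul]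
    refine mul_le_mul_of_nonneg_right ?_ (by positivity)
    rw [Nat.card_Icc]
    have : 2 ^ (J - i) + 1 - 2 ≤ 2 ^ (J - i) := by
      have := Nat.one_le_two_pow (n := J - i)
      omega
    exact_mod_cast this

lemma sum_condDensity_excluded_le {J h : ℕ} (hh : 0 < h) (i : ℕ) :
    ∑ p ∈ primeBlock h i, condDensity (Excluded J h) p ≤ 12 * 2 ^ (J - i) := by
  calc _ ≤ ∑ p ∈ primeBlock h i, (2 ^ (J - i) * (1 / p : ℝ)) :=
        Finset.sum_le_sum fun p hp => condDensity_excluded_le hp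
    _ = 2 ^ (J - i) * ∑ p ∈ primeBlock h i, (1 / p : ℝ) := by rw [Finset.mul_sum]
    _ ≤ 2 ^ (J - i) * 12 :=
        mul_le_mul_of_nonneg_left (sum_inv_primeBlock_le hh i) (by positivity)
    _ = _ := by ring

lemma condDensity_excluded_le_tenth {J i p : ℕ} (hJ : 4 ≤ J)
    (hp : p ∈ primeBlock (2 * J) i) : condDensity (Excluded J (2 * J)) p ≤ 1 / 10 := by
  refine (condDensity_excluded_le hp).trans ?_
  have h1 : 2 ^ (2 * J) < p := lt_of_mem_primeBlock hp
  have h2 : 10 ≤ 2 ^ J := le_trans (by norm_num) (Nat.pow_le_pow_right (by norm_num) hJ)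
  have h3 : 2 ^ (J - i) ≤ 2 ^ J := Nat.pow_le_pow_right (by norm_num) (Nat.sub_le _ _)
  have h4 : 10 * 2 ^ (J - i) ≤ p := by
    rw [two_mul, pow_add] at h1
    exact (Nat.mul_le_mul h2 h3).trans h1.le
  have h5 : (10 : ℝ) * 2 ^ (J - i) ≤ p := by exact_mod_cast h4
  have h6 : (0 : ℝ) < p := by exact_mod_cast (mem_primeBlock.1 hp).2.2.pos
  rw [mul_one_div, div_le_div_iff₀ h6 (by norm_num)]
  linarith

lemma exp_le_prod_one_sub {J : ℕ} (hJ : 4 ≤ J) (i : ℕ) :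
    Real.exp (-24 * 2 ^ (J - i)) ≤
      ∏ p ∈ primeBlock (2 * J) i, (1 - condDensity (Excluded J (2 * J)) p) := by
  have h0 : ∀ p ∈ primeBlock (2 * J) i, 0 ≤ condDensity (Excluded J (2 * J)) p := fun p hp =>
    condDensity_nonneg (B := primeBlock (2 * J) i) (fun p hp => (mem_primeBlock.1 hp).2.2)
      (fun q _ m => excluded_periodic J _ q m) hp
  calc Real.exp (-24 * 2 ^ (J - i))
      ≤ Real.exp (∑ p ∈ primeBlock (2 * J) i, -2 * condDensity (Excluded J (2 * J)) p) := by
        rw [← Finset.mul_sum]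
        refine Real.exp_le_exp.2 ?_
        linarith [sum_condDensity_excluded_le (J := J) (h := 2 * J) (by omega) i]
    _ = ∏ p ∈ primeBlock (2 * J) i, Real.exp (-2 * condDensity (Excluded J (2 * J)) p) :=
        Real.exp_sum _ _
    _ ≤ _ := by
        refine Finset.prod_le_prod (fun _ _ => (Real.exp_pos _).le) fun p hp => ?_
        have h1 := h0 p hp
        have h2 := condDensity_excluded_le_tenth hJ hp
        set x := condDensity (Excluded J (2 * J)) p
        rw [show -2 * x = -(2 * x) by ring, Real.exp_neg, inv_le_iff_one_le_mul₀ (Real.exp_pos _)]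
        have h3 := Real.add_one_le_exp (2 * x)
        have h4 : (1 - x) * (2 * x + 1) ≤ (1 - x) * Real.exp (2 * x) :=
          mul_le_mul_of_nonneg_left h3 (by linarith)
        nlinarith

/-- The Bonferroni series for block `i` is truncated after `64 * 2 ^ (J - i)` terms; the next term
is negligible against the density of the sifted set. -/
lemma elemSym_excluded_le {J : ℕ} (hJ : 4 ≤ J) (i : ℕ) :
    elemSym (condDensity (Excluded J (2 * J))) (primeBlock (2 * J) i)
      (2 * (32 * 2 ^ (J - i)) + 1) ≤ Real.exp (-4 * 2 ^ (J - i)) *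
      ∏ p ∈ primeBlock (2 * J) i, (1 - condDensity (Excluded J (2 * J)) p) := by
  have h1 := elemSym_le_exp (x := condDensity (Excluded J (2 * J))) (B := primeBlock (2 * J) i)
    (fun p hp => condDensity_nonneg (B := primeBlock (2 * J) i)
      (fun p hp => (mem_primeBlock.1 hp).2.2) (fun q _ m => excluded_periodic J _ q m) hp)
    (2 * (32 * 2 ^ (J - i)) + 1)
  refine h1.trans (le_trans ?_ (mul_le_mul_of_nonneg_left (exp_le_prod_one_sub hJ i)
    (Real.exp_pos _).le))
  rw [← Real.exp_add]
  refine Real.exp_le_exp.2 ?_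
  have h2 := sum_condDensity_excluded_le (J := J) (h := 2 * J) (by omega) i
  push_cast
  linarith [pow_pos (two_pos (α := ℝ)) (J - i)]

lemma sum_two_pow_sub_le (J : ℕ) : ∑ i ∈ Finset.range J, (2 : ℝ) ^ (J - i) ≤ 2 * 2 ^ J := by
  have h1 : ∀ J : ℕ, ∑ i ∈ Finset.range J, (2 : ℝ) ^ (J - i) = 2 * 2 ^ J - 2 := by
    intro J
    induction J with
    | zero => simp
    | succ J ih =>
      rw [Finset.sum_range_succ', Finset.sum_congr rfl fun i _ => by
        rw [Nat.add_sub_add_right], ih, Nat.sub_zero, pow_succ]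
      ring
  rw [h1]
  linarith

lemma sum_truncation_error_le (J : ℕ) :
    ∑ i ∈ Finset.range J, Real.exp (-4 * 2 ^ (J - i)) ≤ 1 / 8 := by
  have hexp : Real.exp (-4) ≤ 1 / 16 := by
    have h1 : (2 : ℝ) ≤ Real.exp 1 := by linarith [Real.exp_one_gt_d9]
    have h2 : Real.exp 4 = Real.exp 1 ^ 4 := by rw [← Real.exp_nat_mul]; norm_num
    have h3 : (16 : ℝ) ≤ Real.exp 4 := by
      rw [h2]
      calc (16 : ℝ) = 2 ^ 4 := by norm_num
        _ ≤ _ := pow_le_pow_left₀ (by norm_num) h1 4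
    rw [Real.exp_neg, inv_eq_one_div]
    exact one_div_le_one_div_of_le (by norm_num) h3
  have h1 : ∀ i ∈ Finset.range J, Real.exp (-4 * 2 ^ (J - i)) ≤
      1 / 16 * (1 / 2) ^ (J - 1 - i) := by
    intro i hi
    have hi' := Finset.mem_range.1 hi
    obtain ⟨a, ha⟩ : ∃ a, J - i = a + 1 := ⟨J - 1 - i, by omega⟩
    have ha' : J - 1 - i = a := by omega
    have h2 : a + 1 ≤ 2 ^ (a + 1) := Nat.lt_two_pow_self.le
    rw [ha, ha']
    calc Real.exp (-4 * 2 ^ (a + 1)) = Real.exp (-4) ^ (2 ^ (a + 1)) := by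
          rw [← Real.exp_nat_mul]; push_cast; ring_nf
      _ ≤ (1 / 16) ^ (2 ^ (a + 1)) := pow_le_pow_left₀ (Real.exp_pos _).le hexp _
      _ ≤ (1 / 16) ^ (a + 1) := pow_le_pow_of_le_one (by norm_num) (by norm_num) h2
      _ = 1 / 16 * (1 / 16) ^ a := by ring
      _ ≤ 1 / 16 * (1 / 2) ^ a := by gcongr; norm_num
  refine (Finset.sum_le_sum h1).trans ?_
  rw [← Finset.mul_sum, Finset.sum_range_reflect (fun i => (1 / 2 : ℝ) ^ i) J]
  have := sum_geometric_two_le J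
  linarith

lemma geom_sum_le_pow {Y Z : ℝ} (hY : 0 ≤ Y) (hYZ : Y ≤ Z) (hZ : 2 ≤ Z) (n : ℕ) :
    ∑ j ∈ Finset.range n, Y ^ j ≤ Z ^ n := by
  induction n with
  | zero => simp
  | succ n ih =>
    rw [Finset.sum_range_succ, pow_succ]
    have h1 : Y ^ n ≤ Z ^ n := pow_le_pow_left₀ hY hYZ n
    nlinarith [pow_nonneg (hY.trans hYZ) n]

lemma geom_sum_primeBlock_le {J i : ℕ} (hJ : 4 ≤ J) (hi : i < J) :
    ∑ j ∈ Finset.range (2 * (32 * 2 ^ (J - i)) + 2),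
      (∑ p ∈ primeBlock (2 * J) i, (p : ℝ)) ^ j ≤ 2 ^ (520 * (2 * J * 2 ^ (J + i))) := by
  have hZ : (2 : ℝ) ≤ (2 ^ (2 * J * 4 ^ (i + 1))) ^ 2 := by
    rw [← pow_mul]
    refine le_self_pow₀ (by norm_num) ?_
    have : 0 < 2 * J * 4 ^ (i + 1) * 2 := by positivity
    omega
  refine (geom_sum_le_pow (Finset.sum_nonneg fun _ _ => Nat.cast_nonneg _)
    (sum_primeBlock_le (2 * J) i) hZ _).trans ?_
  rw [← pow_mul, ← pow_mul]
  refine pow_le_pow_right₀ (by norm_num) ?_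
  have h1 : 2 * (32 * 2 ^ (J - i)) + 2 ≤ 65 * 2 ^ (J - i) := by
    have : 2 ^ 1 ≤ 2 ^ (J - i) := Nat.pow_le_pow_right (by norm_num) (by omega)
    omega
  have h2 : 2 ^ (J + i) = 4 ^ i * 2 ^ (J - i) := by
    rw [show (4 : ℕ) = 2 ^ 2 by norm_num, ← pow_mul, ← pow_add]
    congr 1
    omega
  calc 2 * J * 4 ^ (i + 1) * (2 * (2 * (32 * 2 ^ (J - i)) + 2))
      ≤ 2 * J * 4 ^ (i + 1) * (2 * (65 * 2 ^ (J - i))) :=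
        Nat.mul_le_mul_left _ (Nat.mul_le_mul_left _ h1)
    _ = 520 * (2 * J * 2 ^ (J + i)) := by rw [h2]; ring

lemma prod_norm_le (J : ℕ) :
    ∏ i ∈ Finset.range J, (2 : ℝ) ^ (520 * (2 * J * 2 ^ (J + i))) ≤
      (2 ^ (2 * J * 4 ^ J)) ^ 520 := by
  rw [Finset.prod_pow_eq_pow_sum, ← pow_mul]
  refine pow_le_pow_right₀ (by norm_num) ?_
  rw [← Finset.mul_sum, ← Finset.mul_sum, mul_comm 520]
  refine Nat.mul_le_mul_right _ (Nat.mul_le_mul_left _ ?_)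
  simp only [pow_add]
  rw [← Finset.mul_sum, show (4 : ℕ) = 2 * 2 by norm_num, mul_pow]
  exact Nat.mul_le_mul_left _ (Nat.geomSum_lt (le_refl 2) (by simp)).le

lemma inv_le_prod_prod_one_sub {J : ℕ} (hJ : 4 ≤ J) :
    1 / (2 : ℝ) ^ (2 * J * 4 ^ J) ≤ ∏ i ∈ Finset.range J, ∏ p ∈ primeBlock (2 * J) i,
      (1 - condDensity (Excluded J (2 * J)) p) := by
  refine le_trans ?_ (Finset.prod_le_prod (fun _ _ => (Real.exp_pos _).le)
    fun i _ => exp_le_prod_one_sub hJ i)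
  rw [← Real.exp_sum, ← Finset.mul_sum]
  have h1 := sum_two_pow_sub_le J
  have h2 : Real.exp (-(48 * 2 ^ J)) ≤
      Real.exp (-24 * ∑ i ∈ Finset.range J, (2 : ℝ) ^ (J - i)) :=
    Real.exp_le_exp.2 (by linarith)
  refine le_trans ?_ h2
  rw [Real.exp_neg, ← one_div]
  refine one_div_le_one_div_of_le (Real.exp_pos _) ?_
  calc Real.exp (48 * 2 ^ J) = Real.exp 1 ^ (48 * 2 ^ J) := by
        rw [← Real.exp_nat_mul]; push_cast; ring_nf
    _ ≤ (2 ^ 2) ^ (48 * 2 ^ J) :=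
        pow_le_pow_left₀ (Real.exp_pos 1).le (by linarith [Real.exp_one_lt_d9]) _
    _ = 2 ^ (2 * (48 * 2 ^ J)) := by rw [← pow_mul]
    _ ≤ 2 ^ (2 * J * 4 ^ J) := by
        refine pow_le_pow_right₀ (by norm_num) ?_
        have h3 : 2 ^ 4 ≤ 2 ^ J := Nat.pow_le_pow_right (by norm_num) hJ
        rw [show (4 : ℕ) = 2 * 2 by norm_num, mul_pow, mul_assoc]
        refine Nat.mul_le_mul_left _ ?_
        rw [← mul_assoc]
        refine Nat.mul_le_mul_right _ ?_
        nlinarith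

/-! ### The cofactors of `candidate h m - k` -/

/-- The largest prime bound `z = 2 ^ (2 * J * 4 ^ J)` of the sieve. -/
def siftLimit (J : ℕ) : ℕ := 2 ^ (2 * J * 4 ^ J)

/-- The cofactor of `gcd (modulus h) (k - 1)` in `modulus h`. With `cofRes`, it describes
`candidate h m - k` as `gcd (modulus h) (k - 1) * (cofMod h k * (m + 1) - cofRes h k)`. -/
def cofMod (h k : ℕ) : ℕ := modulus h / (modulus h).gcd (k - 1)

/-- The cofactor of `gcd (modulus h) (k - 1)` in `k - 1`. -/
def cofRes (h k : ℕ) : ℕ := (k - 1) / (modulus h).gcd (k - 1)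

/-- The primes up to `z ^ (1 / log₂ k)` which the cofactor of a sifted `candidate h m - k` may
have. -/
def Admissible (J k p : ℕ) : Prop :=
  ¬ p ∣ cofMod (2 * J) k ∧ p ^ Nat.log 2 k ≤ siftLimit J ∧
    ∀ i < J, p ∈ primeBlock (2 * J) i → ∀ k' ∈ Finset.Icc 2 (2 ^ (J - i)), ¬ k ≡ k' [MOD p]

open Classical in
/-- The integers with exactly `600 * log₂ k` prime factors, all admissible. The cofactor of
`candidate h m - k` has to avoid these divisors. -/
noncomputable def badDivisors (J k : ℕ) : Finset ℕ :=
  (Finset.range (siftLimit J ^ 600 + 1)).filter fun d =>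
    d ≠ 0 ∧ ArithmeticFunction.cardFactors d = 600 * Nat.log 2 k ∧
      ∀ p, p.Prime → p ∣ d → Admissible J k p

lemma modulus_pos (h : ℕ) : 0 < modulus h := by unfold modulus; positivity

lemma gcd_modulus_pos (h k : ℕ) : 0 < (modulus h).gcd (k - 1) :=
  Nat.gcd_pos_of_pos_left _ (modulus_pos h)

lemma gcd_mul_cofMod (h k : ℕ) : (modulus h).gcd (k - 1) * cofMod h k = modulus h :=
  Nat.mul_div_cancel' (Nat.gcd_dvd_left _ _)

lemma gcd_mul_cofRes (h k : ℕ) : (modulus h).gcd (k - 1) * cofRes h k = k - 1 :=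
  Nat.mul_div_cancel' (Nat.gcd_dvd_right _ _)

lemma coprime_cofMod_cofRes (h k : ℕ) : (cofMod h k).Coprime (cofRes h k) :=
  Nat.coprime_div_gcd_div_gcd (gcd_modulus_pos h k)

lemma candidate_modEq_of_cofMod {h k m p : ℕ} (hk : 1 ≤ k)
    (hmod : cofMod h k * (m + 1) ≡ cofRes h k [MOD p]) : candidate h m ≡ k [MOD p] := by
  have h1 := (hmod.mul_left ((modulus h).gcd (k - 1))).add_left 1
  rw [← mul_assoc, gcd_mul_cofMod, gcd_mul_cofRes, Nat.add_sub_cancel' hk] at h1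
  exact h1

/-- A prime `p ≤ y` can divide a cofactor only if `k > y`, because `(y!) ^ 2` is divisible by
`p * (k - 1)` otherwise. -/
lemma prime_dvd_cofMod {h k p : ℕ} (hp : p.Prime) (hpy : p ≤ 2 ^ h) (hk : 2 ≤ k)
    (hky : k ≤ 2 ^ h) : p ∣ cofMod h k := by
  have h1 : k - 1 ∣ (2 ^ h).factorial := Nat.dvd_factorial (by omega) (by omega)
  have h2 : p ∣ (2 ^ h).factorial := Nat.dvd_factorial hp.pos hpy
  have h3 : (k - 1) * p ∣ modulus h := by
    rw [modulus, sq]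
    exact mul_dvd_mul h1 h2
  have h4 : (modulus h).gcd (k - 1) = k - 1 :=
    Nat.gcd_eq_right ((dvd_mul_right _ _).trans h3)
  have h5 := gcd_mul_cofMod h k
  rw [h4] at h5
  rw [← h5] at h3
  exact Nat.dvd_of_mul_dvd_mul_left (by omega) h3

lemma log_two_pos_of_two_le {k : ℕ} (hk : 2 ≤ k) : 1 ≤ Nat.log 2 k :=
  Nat.log_pos (by norm_num) hk

open Classical in
lemma sum_inv_admissible_le {J k : ℕ} (hJ : 4 ≤ J) (hk : 2 ≤ k) :
    ∑ p ∈ (Finset.range (siftLimit J + 1)).filter (fun p => p.Prime ∧ Admissible J k p),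
      (1 / p : ℝ) ≤ 14 * Nat.log 2 k := by
  set l := Nat.log 2 k with hl
  set A : Finset ℕ := if 2 * J ≤ l then (Finset.Icc 1 (2 ^ (2 * J))).filter Nat.Prime else ∅
    with hA
  set I : Finset ℕ := (Finset.range J).filter (fun i => J - i ≤ l) with hI
  have hsub : (Finset.range (siftLimit J + 1)).filter (fun p => p.Prime ∧ Admissible J k p) ⊆
      A ∪ I.biUnion (primeBlock (2 * J)) := by
    intro p hp
    obtain ⟨hpz, hpp, hadm1, -, hadm3⟩ := by simpa [Admissible] using hp
    rw [Finset.mem_union]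
    rcases le_or_gt p (2 ^ (2 * J)) with hpy | hpy
    · left
      have hky : 2 ^ (2 * J) < k := by
        by_contra hcon
        exact hadm1 (prime_dvd_cofMod hpp hpy hk (not_lt.1 hcon))
      have : 2 * J ≤ l := Nat.le_log_of_pow_le (by norm_num) hky.le
      rw [hA, if_pos this]
      simp [hpp, hpy, hpp.one_lt.le]
    · right
      obtain ⟨i, hi, hpi⟩ := exists_mem_primeBlock hpp hpy (by
        have : p ≤ siftLimit J := by omega
        exact this)
      refine Finset.mem_biUnion.2 ⟨i, ?_, hpi⟩
      have hki : 2 ^ (J - i) < k := by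
        by_contra hcon
        exact hadm3 i hi hpi k hk (not_lt.1 hcon) rfl
      simp only [hI, Finset.mem_filter, Finset.mem_range]
      exact ⟨hi, Nat.le_log_of_pow_le (by norm_num) hki.le⟩
  have hIcard : I.card ≤ l := by
    calc I.card ≤ (Finset.Ico (J - l) J).card := by
          refine Finset.card_le_card fun i hi => ?_
          simp only [hI, Finset.mem_filter, Finset.mem_range, Finset.mem_Ico] at hi ⊢
          omega
      _ ≤ l := by rw [Nat.card_Ico]; omega
  have hAsum : ∑ p ∈ A, (1 / p : ℝ) ≤ 2 * l := by
    rw [hA]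
    split_ifs with h
    · have h1 := sum_inv_primes_le (2 * J)
      have h2 : ((2 * J : ℕ) : ℝ) ≤ l := by exact_mod_cast h
      have h3 : (1 : ℝ) ≤ (2 * J : ℕ) := by exact_mod_cast (by omega : 1 ≤ 2 * J)
      linarith
    · simp
  have hIsum : ∑ p ∈ I.biUnion (primeBlock (2 * J)), (1 / p : ℝ) ≤ 12 * l := by
    rw [Finset.sum_biUnion]
    · calc _ ≤ ∑ i ∈ I, (12 : ℝ) :=
            Finset.sum_le_sum fun i _ => sum_inv_primeBlock_le (by omega) i
        _ = 12 * I.card := by rw [Finset.sum_const, nsmul_eq_mul, mul_comm]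
        _ ≤ _ := by
          have : (I.card : ℝ) ≤ l := by exact_mod_cast hIcard
          linarith
    · intro i _ j _ hij
      exact Finset.disjoint_left.2 fun p hp hp' => hij (primeBlock_eq_of_mem hp hp')
  have h1 : ∑ p ∈ (Finset.range (siftLimit J + 1)).filter (fun p => p.Prime ∧ Admissible J k p),
      (1 / p : ℝ) ≤ ∑ p ∈ A ∪ I.biUnion (primeBlock (2 * J)), (1 / p : ℝ) :=
    Finset.sum_le_sum_of_subset_of_nonneg hsub fun _ _ _ => by positivity
  have h2 := Finset.sum_union_inter (s₁ := A) (s₂ := I.biUnion (primeBlock (2 * J)))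
      (f := fun p => (1 / p : ℝ))
  have h3 : 0 ≤ ∑ p ∈ A ∩ I.biUnion (primeBlock (2 * J)), (1 / p : ℝ) :=
    Finset.sum_nonneg fun _ _ => by positivity
  linarith

lemma sum_badDivisors_le {J k : ℕ} (hJ : 4 ≤ J) (hk : 2 ≤ k) :
    ∑ d ∈ badDivisors J k, ((10 / 9 : ℝ) ^ ArithmeticFunction.cardFactors d / d) ≤
      1 / 16 * ((k : ℝ) ^ 2)⁻¹ := by
  classical
  have hl := log_two_pos_of_two_le hk
  have h1 := sum_cardFactors_eq_le (r := 600 * Nat.log 2 k)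
    (P := (Finset.range (siftLimit J + 1)).filter (fun p => p.Prime ∧ Admissible J k p))
    (E := badDivisors J k) (fun p hp => (Finset.mem_filter.1 hp).2.1) (fun d hd => by
      obtain ⟨-, hd0, hdΩ, hdp⟩ := Finset.mem_filter.1 hd
      refine ⟨hd0, hdΩ, fun p hp hpd => Finset.mem_filter.2 ⟨?_, hp, hdp p hp hpd⟩⟩
      have h2 : p ≤ p ^ Nat.log 2 k := Nat.le_self_pow (by omega) p
      exact Finset.mem_range.2 (Nat.lt_succ_of_le (h2.trans (hdp p hp hpd).2.1)))
  have h2 := sum_inv_admissible_le hJ hk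
  have h3 := Nat.lt_pow_succ_log_self (b := 2) (by norm_num) k
  set l := Nat.log 2 k with hl'
  refine h1.trans ?_
  -- `(2 / 3) ^ 600 * exp 140 ≤ (1 / 2) ^ 20`
  have h4 : (2 / 3 : ℝ) ^ (600 * l) ≤ (1 / 2) ^ (300 * l) := by
    rw [show 600 * l = 2 * (300 * l) by ring, pow_mul]
    exact pow_le_pow_left₀ (by norm_num) (by norm_num) _
  have h5 : Real.exp (10 * ∑ p ∈ (Finset.range (siftLimit J + 1)).filter
      (fun p => p.Prime ∧ Admissible J k p), (1 / p : ℝ)) ≤ 2 ^ (280 * l) := by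
    calc _ ≤ Real.exp ((140 * l : ℕ) * 1) := Real.exp_le_exp.2 (by push_cast; linarith)
      _ = Real.exp 1 ^ (140 * l) := Real.exp_nat_mul _ _
      _ ≤ (2 ^ 2) ^ (140 * l) :=
        pow_le_pow_left₀ (Real.exp_pos 1).le (by linarith [Real.exp_one_lt_d9]) _
      _ = 2 ^ (280 * l) := by rw [← pow_mul]; ring_nf
  have h6 : (k : ℝ) ≤ 2 ^ (2 * l) := by
    have : k ≤ 2 ^ (2 * l) := h3.le.trans (Nat.pow_le_pow_right (by norm_num) (by omega))
    exact_mod_cast this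
  have hk0 : (0 : ℝ) < k := by exact_mod_cast (by omega : 0 < k)
  calc _ ≤ (1 / 2 : ℝ) ^ (300 * l) * 2 ^ (280 * l) :=
        mul_le_mul h4 h5 (Real.exp_pos _).le (by positivity)
    _ = ((2 : ℝ) ^ (20 * l))⁻¹ := by
        rw [show 300 * l = 280 * l + 20 * l by ring, pow_add, mul_right_comm, ← mul_pow]
        rw [one_div_mul_cancel two_ne_zero, one_pow, one_mul, one_div, inv_pow]
    _ ≤ (16 * (k : ℝ) ^ 2)⁻¹ := by
        refine inv_anti₀ (by positivity) ?_
        calc 16 * (k : ℝ) ^ 2 ≤ 2 ^ 4 * (2 ^ (2 * l)) ^ 2 := by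
              have := pow_le_pow_left₀ hk0.le h6 2
              linarith
          _ = 2 ^ (4 + 4 * l) := by rw [← pow_mul, ← pow_add]; ring_nf
          _ ≤ 2 ^ (20 * l) := pow_le_pow_right₀ (by norm_num) (by omega)
    _ = _ := by rw [mul_inv]; norm_num

set_option exponentiation.threshold 2000 in
/-- There is a candidate outside all excluded classes whose cofactors have no bad divisor. -/
lemma exists_good_candidate {J : ℕ} (hJ : 4 ≤ J) :
    ∃ m < siftLimit J ^ 1130, (∀ p, ¬ Excluded J (2 * J) p m) ∧
      ∀ k, 2 ≤ k → k ≤ siftLimit J → ∀ d ∈ badDivisors J k,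
        ¬ cofMod (2 * J) k * (m + 1) ≡ cofRes (2 * J) k [MOD d] := by
  classical
  set z := siftLimit J with hz
  have hmem : ∀ {k d : ℕ}, d ∈ badDivisors J k → d ≤ z ^ 600 ∧ d ≠ 0 ∧
      ArithmeticFunction.cardFactors d = 600 * Nat.log 2 k ∧
      ∀ p, p.Prime → p ∣ d → Admissible J k p := fun {k d} hd => by
    obtain ⟨h1, h2⟩ := Finset.mem_filter.1 hd
    exact ⟨Nat.lt_succ_iff.1 (Finset.mem_range.1 h1), h2⟩
  have hres : ∀ e : (_ : ℕ) × ℕ, ∃ a, e.2 ∈ badDivisors J e.1 →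
      ∀ m, cofMod (2 * J) e.1 * (m + 1) ≡ cofRes (2 * J) e.1 [MOD e.2] ↔ m ≡ a [MOD e.2] := by
    rintro ⟨k, d⟩
    by_cases hd : d ∈ badDivisors J k
    · obtain ⟨-, hd0, -, hdp⟩ := hmem hd
      have hcop : (cofMod (2 * J) k).Coprime d :=
        Nat.Coprime.symm (Nat.coprime_of_dvd fun p hp hpd => (hdp p hp hpd).1)
      obtain ⟨a, ha⟩ := exists_residue_iff (Nat.pos_of_ne_zero hd0) hcop (cofRes (2 * J) k)
      exact ⟨a, fun _ => ha⟩
    · exact ⟨0, fun h => absurd h hd⟩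
  choose a ha using hres
  set E := (Finset.Icc 2 z).sigma (badDivisors J) with hE
  have hEmem : ∀ e ∈ E, (2 ≤ e.1 ∧ e.1 ≤ z) ∧ e.2 ∈ badDivisors J e.1 := fun e he => by
    simpa [hE] using he
  have hz2 : 2 ≤ z := by
    rw [hz, siftLimit]
    exact Nat.le_self_pow (by positivity) 2
  have hJz : 1 + J ≤ z := by
    have h1 : J < 2 ^ J := Nat.lt_two_pow_self
    have h2 : 2 ^ J ≤ z := Nat.pow_le_pow_right (by norm_num) (by
      rw [mul_comm 2 J, mul_assoc]
      exact Nat.le_mul_of_pos_right J (by positivity))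
    omega
  have hzR : (2 : ℝ) ≤ z := by exact_mod_cast hz2
  have hEcard : E.card ≤ z ^ 602 := by
    rw [hE, Finset.card_sigma]
    calc ∑ k ∈ Finset.Icc 2 z, (badDivisors J k).card ≤ ∑ k ∈ Finset.Icc 2 z, (z ^ 600 + 1) := by
          refine Finset.sum_le_sum fun k _ => (Finset.card_filter_le _ _).trans ?_
          rw [Finset.card_range]
      _ = (z + 1 - 2) * (z ^ 600 + 1) := by rw [Finset.sum_const, Nat.card_Icc, smul_eq_mul]
      _ ≤ z * (z ^ 600 * z) := by
          refine Nat.mul_le_mul (by omega) ?_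
          have : 1 ≤ z ^ 600 := Nat.one_le_pow _ _ (by omega)
          nlinarith
      _ = z ^ 602 := by ring
  obtain ⟨m, hmX, hsift, hev⟩ := exists_sifted (s := Finset.range J) (B := primeBlock (2 * J))
    (R := Excluded J (2 * J)) (r := fun i => 32 * 2 ^ (J - i))
    (ε := fun i => Real.exp (-4 * 2 ^ (J - i)))
    (N := fun i => 2 ^ (520 * (2 * J * 2 ^ (J + i)))) (E := E) (d := fun e => e.2) (a := a)
    (X := z ^ 1130)
    (fun i _ p hp => (mem_primeBlock.1 hp).2.2)
    (fun i _ j _ hij => Finset.disjoint_left.2 fun p hp hp' => hij (primeBlock_eq_of_mem hp hp'))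
    (fun i _ p _ m => excluded_periodic J (2 * J) p m)
    (fun i _ p hp => condDensity_excluded_le_tenth hJ hp)
    (fun i _ => elemSym_excluded_le hJ i)
    (sum_truncation_error_le J)
    (fun i hi => geom_sum_primeBlock_le hJ (Finset.mem_range.1 hi))
    (fun e he => (hmem (hEmem e he).2).2.1)
    (by
      rintro e he i - p hp hpd m hm ⟨i', hi', hpi', k', hk', hmod⟩
      obtain ⟨⟨hk2, -⟩, hbad⟩ := hEmem e he
      have h1 := ((ha e hbad m).2 hm).of_dvd hpd
      have h2 := candidate_modEq_of_cofMod (by omega) h1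
      exact ((hmem hbad).2.2.2 p (mem_primeBlock.1 hp).2.2 hpd).2.2 i' hi' hpi' k' hk'
        (h2.symm.trans hmod))
    (by
      rw [hE, Finset.sum_sigma]
      calc _ ≤ ∑ k ∈ Finset.Icc 2 z, (1 / 16 * ((k : ℝ) ^ 2)⁻¹) :=
            Finset.sum_le_sum fun k hk => sum_badDivisors_le hJ (Finset.mem_Icc.1 hk).1
        _ ≤ 1 / 16 * 1 := by
            rw [← Finset.mul_sum]
            refine mul_le_mul_of_nonneg_left ?_ (by norm_num)
            have h1 := sum_Ioc_inv_sq_le_sub (α := ℝ) one_ne_zero (by omega : 1 ≤ z)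
            have h2 : Finset.Icc 2 z = Finset.Ioc 1 z := by
              ext; simp [Finset.mem_Icc, Finset.mem_Ioc, Nat.succ_le_iff]
            rw [h2]
            refine h1.trans ?_
            have : (0 : ℝ) ≤ (z : ℝ)⁻¹ := by positivity
            push_cast
            linarith
        _ ≤ 1 / 8 := by norm_num)
    (by
      have h1 := prod_norm_le J
      have h2 := inv_le_prod_prod_one_sub hJ
      have hzc : (2 : ℝ) ^ (2 * J * 4 ^ J) = z := by rw [hz, siftLimit]; push_cast; rfl
      rw [hzc] at h1 h2
      have h3 : (1 : ℝ) + J + E.card ≤ z + z ^ 602 := by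
        have h4 : (1 : ℝ) + J ≤ z := by exact_mod_cast hJz
        have h5 : (E.card : ℝ) ≤ z ^ 602 := by exact_mod_cast hEcard
        linarith
      have hz0 : (0 : ℝ) < z := by linarith
      have h6 : (z : ℝ) ≤ z ^ 602 := le_self_pow₀ (by linarith) (by norm_num)
      rw [Finset.card_range]
      calc _ ≤ (z : ℝ) ^ 520 * (z ^ 602 + z ^ 602) :=
            mul_le_mul h1 (h3.trans (by linarith)) (by positivity) (by positivity)
        _ = 2 * z ^ 1122 := by ring
        _ < (z * z * z) * z ^ 1122 := by
            refine mul_lt_mul_of_pos_right ?_ (by positivity)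
            nlinarith
        _ = z ^ 1125 * 1 := by ring
        _ ≤ z ^ 1125 * (z ^ 4 / 2) := by
            refine mul_le_mul_of_nonneg_left ?_ (by positivity)
            have := pow_le_pow_left₀ (by norm_num) hzR 4
            linarith
        _ = z ^ 1130 * (1 / z / 2) := by
            field_simp
        _ ≤ _ := by
            push_cast
            refine mul_le_mul_of_nonneg_left ?_ (by positivity)
            exact div_le_div_of_nonneg_right h2 (by norm_num))
  refine ⟨m, hmX, fun p hp => ?_, fun k hk2 hkz d hd hmod => ?_⟩
  · obtain ⟨i, hi, hpi, -⟩ := id hp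
    exact hsift i (Finset.mem_range.2 hi) p hpi hp
  · exact hev ⟨k, d⟩ (by simp [hE, hk2, hkz, hd]) ((ha ⟨k, d⟩ hd m).1 hmod)

lemma modulus_le (J : ℕ) : modulus (2 * J) ≤ siftLimit J ^ 2 := by
  refine Nat.pow_le_pow_left ((Nat.factorial_le_pow _).trans ?_) 2
  rw [siftLimit, ← pow_mul, show (4 : ℕ) = 2 ^ 2 by norm_num, ← pow_mul]

set_option exponentiation.threshold 2000 in
/-- For a good candidate `n`, the prime factors of `n - k` are split into those of
`gcd (modulus h) (k - 1)`, those above `z ^ (1 / log₂ k)`, and admissible ones. -/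
lemma cardFactors_candidate_sub_le {J m k : ℕ} (hJ : 4 ≤ J) (hm : m < siftLimit J ^ 1130)
    (hsift : ∀ p, ¬ Excluded J (2 * J) p m)
    (hbad : ∀ k, 2 ≤ k → k ≤ siftLimit J → ∀ d ∈ badDivisors J k,
      ¬ cofMod (2 * J) k * (m + 1) ≡ cofRes (2 * J) k [MOD d])
    (hk : 2 ≤ k) (hkn : k < candidate (2 * J) m) :
    ArithmeticFunction.cardFactors (candidate (2 * J) m - k) ≤ 1734 * Nat.log 2 k := by
  classical
  set z := siftLimit J with hz
  set n := candidate (2 * J) m with hn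
  set l := Nat.log 2 k with hl
  have hl1 : 1 ≤ l := log_two_pos_of_two_le hk
  have hz2 : 2 ≤ z := by
    rw [hz, siftLimit]
    exact Nat.le_self_pow (by positivity) 2
  have hnz : n ≤ z ^ 1133 := by
    calc n ≤ 1 + z ^ 2 * z ^ 1130 := by
          rw [hn, candidate]
          exact Nat.add_le_add_left (Nat.mul_le_mul (modulus_le J) hm) 1
      _ = 1 + z ^ 1132 := by ring
      _ ≤ z ^ 1132 * z := by
          have : 1 ≤ z ^ 1132 := Nat.one_le_pow _ _ (by omega)
          nlinarith
      _ = z ^ 1133 := by rw [← pow_succ]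
  rcases lt_or_ge z k with hzk | hkz
  -- for `k > z` the bound `Ω (n - k) ≤ log₂ n` is enough
  · have h1 : 2 ^ ArithmeticFunction.cardFactors (n - k) ≤ 2 ^ (2 * J * 4 ^ J * 1133) := by
      rw [pow_mul]
      exact (pow_cardFactors_le (by omega)).trans ((Nat.sub_le _ _).trans hnz)
    have h2 := (Nat.pow_le_pow_iff_right (by norm_num)).1 h1
    have h3 : 2 * J * 4 ^ J ≤ l := Nat.le_log_of_pow_le (by norm_num) hzk.le
    omega
  set g := (modulus (2 * J)).gcd (k - 1) with hg
  have hg0 : 0 < g := gcd_modulus_pos _ _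
  have hgk : g ≤ k := (Nat.le_of_dvd (by omega) (Nat.gcd_dvd_right _ _)).trans (Nat.sub_le _ _)
  set L := cofMod (2 * J) k * (m + 1) - cofRes (2 * J) k with hL
  have hgL : n - k = g * L := by
    rw [hL, Nat.mul_sub, ← mul_assoc, gcd_mul_cofMod, gcd_mul_cofRes, hn, candidate]
    omega
  have hL0 : L ≠ 0 := by
    rintro h0
    rw [h0, mul_zero] at hgL
    omega
  have hLz : L ≤ z ^ 1133 := by
    have h1 : L ≤ g * L := Nat.le_mul_of_pos_left L hg0
    omega
  have hmodL : ∀ d, d ∣ L → cofMod (2 * J) k * (m + 1) ≡ cofRes (2 * J) k [MOD d] := by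
    intro d hd
    exact ((Nat.modEq_iff_dvd' (by omega)).2 hd).symm
  have hadm : ∀ p, p.Prime → p ∣ L → p ^ l ≤ z → Admissible J k p := by
    intro p hp hpL hpz
    refine ⟨fun hpW => ?_, hpz, fun i hi hpi k' hk' hkk' => ?_⟩
    · have h1 : cofRes (2 * J) k ≡ 0 [MOD p] :=
        (hmodL p hpL).symm.trans (Nat.modEq_zero_iff_dvd.2 (hpW.mul_right _))
      exact hp.one_lt.ne' (Nat.dvd_one.1 ((coprime_cofMod_cofRes (2 * J) k) ▸
        Nat.dvd_gcd hpW (Nat.modEq_zero_iff_dvd.1 h1)))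
    · exact hsift p ⟨i, hi, hpi, k', hk',
        (candidate_modEq_of_cofMod (by omega) (hmodL p hpL)).trans hkk'⟩
  have hsmall : (L.primeFactorsList.filter (fun p => p ^ l ≤ z)).length < 600 * l := by
    by_contra hcon
    obtain ⟨d, hdL, hdΩ, hdp⟩ := exists_dvd_cardFactors_eq hL0 (fun p => p ^ l ≤ z)
      (not_lt.1 hcon)
    have hd0 : d ≠ 0 := by
      rintro rfl
      exact hL0 (zero_dvd_iff.1 hdL)
    refine hbad k hk hkz d (Finset.mem_filter.2 ⟨?_, hd0, hdΩ, fun p hp hpd =>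
      hadm p hp (hpd.trans hdL) (hdp p hp hpd)⟩) (hmodL d hdL)
    have h1 := pow_le_of_forall_prime_pow_le hd0 hdp
    rw [hdΩ, pow_mul] at h1
    exact Finset.mem_range.2 (Nat.lt_succ_of_le ((Nat.pow_le_pow_iff_left (by omega)).1 h1))
  have hlarge := length_filter_large_primes_le (l := l) hL0 (by omega : 1 < z) hLz
  have hLΩ : ArithmeticFunction.cardFactors L ≤ 600 * l + 1133 * l := by
    rw [ArithmeticFunction.cardFactors_apply,
      List.length_eq_length_filter_add (fun p => decide (p ^ l ≤ z))]
    have h1 : L.primeFactorsList.filter (fun p => !decide (p ^ l ≤ z)) =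
        L.primeFactorsList.filter (fun p => ¬ p ^ l ≤ z) := by
      congr 1
      funext p
      by_cases h : p ^ l ≤ z <;> simp [h]
    rw [h1]
    omega
  have hgΩ : ArithmeticFunction.cardFactors g ≤ l :=
    Nat.le_log_of_pow_le (by norm_num) ((pow_cardFactors_le hg0.ne').trans hgk)
  rw [hgL, ArithmeticFunction.cardFactors_mul hg0.ne' hL0]
  omega

theorem theorem2 :
    ∃ C : ℝ, 0 < C ∧
      {n : ℕ | 0 < n ∧ ∀ k : ℕ, 1 < k → k < n →
        ArithmeticFunction.cardDistinctFactors (n - k) ≤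
            ArithmeticFunction.cardFactors (n - k) ∧
          (ArithmeticFunction.cardFactors (n - k) : ℝ) ≤ C * Real.log (k : ℝ)}.Infinite := by
  have hlog2 : 0 < Real.log 2 := Real.log_pos (by norm_num)
  refine ⟨1734 / Real.log 2, by positivity, Set.infinite_of_forall_exists_gt fun a => ?_⟩
  obtain ⟨m, hm, hsift, hbad⟩ := exists_good_candidate (J := a + 4) (by omega)
  refine ⟨candidate (2 * (a + 4)) m, ⟨by unfold candidate; omega, fun k hk hkn =>
    ⟨cardDistinctFactors_le_cardFactors _, ?_⟩⟩, ?_⟩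
  · have h1 := cardFactors_candidate_sub_le (by omega) hm hsift hbad hk hkn
    have h2 : ((2 ^ Nat.log 2 k : ℕ) : ℝ) ≤ k := by
      exact_mod_cast Nat.pow_log_le_self 2 (by omega)
    have h3 : (Nat.log 2 k : ℝ) * Real.log 2 ≤ Real.log k := by
      rw [← Real.log_pow]
      refine Real.log_le_log (by positivity) ?_
      exact_mod_cast h2
    have h4 : (ArithmeticFunction.cardFactors (candidate (2 * (a + 4)) m - k) : ℝ) ≤
        1734 * Nat.log 2 k := by exact_mod_cast h1
    rw [div_mul_eq_mul_div, le_div_iff₀ hlog2]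
    calc _ ≤ 1734 * (Nat.log 2 k : ℝ) * Real.log 2 := mul_le_mul_of_nonneg_right h4 hlog2.le
      _ ≤ _ := by linarith
  · have h1 : 2 * (a + 4) < 2 ^ (2 * (a + 4)) := Nat.lt_two_pow_self
    have h2 : 2 ^ (2 * (a + 4)) ≤ modulus (2 * (a + 4)) :=
      (Nat.self_le_factorial _).trans (Nat.le_self_pow (by norm_num) _)
    have h3 : modulus (2 * (a + 4)) ≤ modulus (2 * (a + 4)) * (m + 1) :=
      Nat.le_mul_of_pos_right _ (by omega)
    unfold candidate
    omega
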